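/- Let $(\mathcal C,\otimes,1_\otimes)$ be a symmetric monoidal category with all small limits, with final object $\star_{\mathcal C}$. \emph{Wreath categories.} Let $\Sigma_*$ be the category of finite sets and bijections. For a category $\mathcal A$ let $\Sigma_*\wr\mathcal A$ be the category of finite families $\{A_s\}_{s\in S}$ of objects of $\mathcal A$; a morphism $\{A_s\}_{s\in S}\to\{B_t\}_{t\in T}$ is a bijection $\sigma:S\to T$ with morphisms $A_s\to B_{\sigma(s)}$. Put $\Sigma_*^{\wr 1}=\Sigma_*$ and $\Sigma_*^{\wr(n+1)}=\Sigma_*\wr\Sigma_*^{\wr n}$. Let $\gamma^2:\Sigma_*\wr\Sigma_*\to\Sigma_*$, $\{S_t\}_{t\in T}\mapsto\coprod_{t}S_t$, and let $\gamma^n:\Sigma_*^{\wr n}\to\Sigma_*$ be the iterated disjoint union. For $1\le i\le n-1$ let $\partial^n_i=\mathrm{Id}\wr\gamma^2\wr\mathrm{Id}:\Sigma_*^{\wr n}\to\Sigma_*^{\wr(n-1)}$ be the functor that applies $\gamma^2$ to the $i$-th and $(i+1)$-st factors, and for $0\le j<n$ let $s^n_j:\Sigma_*^{\wr n}\to\Sigma_*^{\wr(n+1)}$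 be the functor that replaces each $A$ at level $j$ (counted from the outside) by the one-element family $\{A\}_{\star}$. Then canonically $\gamma^{n-1}\partial^n_i\cong\gamma^n$ and $\gamma^{n+1}s^n_j\cong\gamma^n$. \emph{Products.} A symmetric sequence is a functor $\Sigma_*\to\mathcal C$. For a symmetric sequence $A$ and a functor $B:\mathcal A\to\mathcal C$ let $A\circledcirc B:\Sigma_*\wr\mathcal A\to\mathcal C$, $\{a_s\}_{s\in S}\mapsto A(S)\otimes\bigotimes_{s\in S}B(a_s)$. For symmetric sequences put $A_1\circledcirc\cdots\circledcirc A_n=A_1\circledcirc(A_2\circledcirc\cdots):\Sigma_*^{\wr n}\to\mathcal C$, and let $A_1\hat\circ\cdots\hat\circ A_n:\Sigma_*\to\mathcal C$ be its right Kan extension along $\gamma^n$, with universal transformation $\iota:(A_1\hat\circ\cdots\hat\circ A_n)\gamma^n\to A_1\circledcirc\cdots\circledcirc A_n$ (for $n=1$ this is $A_1$ and $\iota=\mathrm{id}$). \emph{Cooperads and comodules.} Let $\mathbb 1$ be the symmetric sequence with $\mathbb 1(T)=1_\otimes$ if $|T|=1$ and $\mathbb 1(T)=\star_{\mathcal C}$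 otherwise. A counital cooperad is a symmetric sequence $\mathcal O$ with natural transformations $\tilde\Delta:\mathcal O\gamma^2\to\mathcal O\circledcirc\mathcal O$ and $\tilde\epsilon:\mathcal O\to\mathbb 1$ such that the two transformations $\mathcal O\gamma^3\to\mathcal O\circledcirc\mathcal O\circledcirc\mathcal O$ (apply $\tilde\Delta$, then $\tilde\Delta$ to the first, respectively to the second, factor) agree, and such that the compositions $\mathcal O=\mathcal O\gamma^2s^1_0\to(\mathcal O\circledcirc\mathcal O)s^1_0\to(\mathbb 1\circledcirc\mathcal O)s^1_0=\mathcal O$ and $\mathcal O=\mathcal O\gamma^2s^1_1\to(\mathcal O\circledcirc\mathcal O)s^1_1\to(\mathcal O\circledcirc\mathbb 1)s^1_1=\mathcal O$, where $s^1_1(S)=\{\star\}_{s\in S}$, are identities. A left $\mathcal O$-comodule is a symmetric sequence $M$ with a natural transformation $\tilde\Delta_M:M\gamma^2\to\mathcal O\circledcirc M$ such that the two transformations $M\gamma^3\to\mathcal O\circledcirc\mathcal O\circledcirc M$ (apply $\tilde\Delta_M$, then $\tilde\Delta$ to $\mathcal O$, respectively $\tilde\Delta_M$ to $M$) agree, and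 such that $M=M\gamma^2s^1_0\to(\mathcal O\circledcirc M)s^1_0\to(\mathbb 1\circledcirc M)s^1_0=M$ is the identity. \emph{Theorem.} Let $\mathcal O$ be a counital cooperad, $M$ a left $\mathcal O$-comodule, and $X^n=\mathcal O^{\hat\circ n}\hat\circ M$ ($n$ factors $\mathcal O$, $X^0=M$) for $n\ge0$. For $n\ge 0$ and $1\le i\le n+1$ let $\tilde\Delta_i:(\mathcal O^{\circledcirc n}\circledcirc M)\,\partial^{n+2}_i\to\mathcal O^{\circledcirc(n+1)}\circledcirc M$ apply $\tilde\Delta$ at the $i$-th factor $\mathcal O$ if $i\le n$, and $\tilde\Delta_M$ at $M$ if $i=n+1$; for $0\le j\le n$ let $\tilde\epsilon_j:(\mathcal O^{\circledcirc(n+1)}\circledcirc M)\,s^{n+1}_j\to\mathcal O^{\circledcirc n}\circledcirc M$ apply $\tilde\epsilon$ at the $(j+1)$-st factor $\mathcal O$. Then: \begin{enumerate} \item There are unique natural transformations $\Delta_i:X^n\to X^{n+1}$ ($1\le i\le n+1$) and $\epsilon_j:X^{n+1}\to X^n$ ($0\le j\le n$) with $\iota\circ\Delta_i\gamma^{n+2}=\tilde\Delta_i\circ\iota\partial^{n+2}_i$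 and $\iota\circ\epsilon_j\gamma^{n+1}=\tilde\epsilon_j\circ\iota s^{n+1}_j$ (up to the canonical identifications $\gamma\partial_i\cong\gamma$, $\gamma s_j\cong\gamma$). \item These maps make $M\to\mathcal O\hat\circ M\rightrightarrows\mathcal O^{\hat\circ2}\hat\circ M\cdots$ a coaugmented cosimplicial symmetric sequence with one extra codegeneracy: there is a cosimplicial object with $k$-th term $X^{k+1}$, cofaces $d^i=\Delta_{i+1}:X^{k+1}\to X^{k+2}$ ($0\le i\le k+1$) and codegeneracies $s^j=\epsilon_{j+1}:X^{k+2}\to X^{k+1}$ ($0\le j\le k$), coaugmented by $\Delta_1:M\to\mathcal O\hat\circ M$; and the maps $s^{-1}=\epsilon_0:X^{k+1}\to X^{k}$ ($k\ge0$) satisfy, together with the coaugmentation and the other maps, $s^{-1}d^0=\mathrm{id}$ (including $\epsilon_0\Delta_1=\mathrm{id}_M$), $s^{-1}d^{i+1}=d^is^{-1}$ (including $\epsilon_0\Delta_2=\Delta_1\epsilon_0$ on $\mathcal O\hat\circ M$), $s^{-1}s^0=s^{-1}s^{-1}$ and $s^{-1}s^{j+1}=s^js^{-1}$. \end{enumerate}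 -/

import Mathlib

open CategoryTheory MonoidalCategory Limits

noncomputable section

namespace CooperadComplex

universe v u

/-! ### Unordered finite tensor products in a symmetric monoidal category -/

section Tensor

variable {C : Type u} [Category.{v} C] [MonoidalCategory C]

/-- The tensor product `X a₁ ⊗ (X a₂ ⊗ (⋯ ⊗ 𝟙_ C))` along a list. -/
abbrev listTensor {κ : Type} (X : κ → C) : List κ → C
  | [] => 𝟙_ C
  | a :: l => X a ⊗ listTensor X l

/-- Factorwise morphisms between tensor products along a list. -/
def listTensorMap {κ : Type} {X Y : κ → C} (f : ∀ k, X k ⟶ Y k) :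
    ∀ l : List κ, listTensor X l ⟶ listTensor Y l
  | [] => 𝟙 _
  | a :: l => f a ⊗ₘ listTensorMap f l

/-- Renaming the indices of a tensor product along a list (factorwise the identity). -/
def listTensorRelabel {ι κ : Type} (e : ι → κ) (Y : κ → C) :
    ∀ l : List ι, listTensor (fun i => Y (e i)) l ≅ listTensor Y (l.map e)
  | [] => Iso.refl _
  | a :: l => whiskerLeftIso (Y (e a)) (listTensorRelabel e Y l)

/-- The tensor product along a concatenation (reassociation). -/
def listTensorAppend {κ : Type} (X : κ → C) :
    ∀ l l' : List κ, listTensor X (l ++ l') ≅ listTensor X l ⊗ listTensor X l'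
  | [], l' => (λ_ (listTensor X l')).symm
  | a :: l, l' =>
      whiskerLeftIso (X a) (listTensorAppend X l l') ≪≫ (α_ (X a) _ _).symm

/-- Rearrangements of a list, as words in adjacent transpositions. -/
inductive Rearr {κ : Type} : List κ → List κ → Type
  | nil : Rearr [] []
  | cons (a : κ) {l l' : List κ} : Rearr l l' → Rearr (a :: l) (a :: l')
  | swap (a b : κ) (l : List κ) : Rearr (a :: b :: l) (b :: a :: l)
  | trans {l l' l'' : List κ} : Rearr l l' → Rearr l' l'' → Rearr l l''

theorem Rearr.nonempty_of_perm {κ : Type} {l l' : List κ} (h : l.Perm l') :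
    Nonempty (Rearr l l') := by
  induction h with
  | nil => exact ⟨.nil⟩
  | cons a _ ih => exact ⟨.cons a ih.some⟩
  | swap a b l => exact ⟨.swap b a l⟩
  | trans _ _ ih ih' => exact ⟨.trans ih.some ih'.some⟩

theorem Rearr.perm {κ : Type} {l l' : List κ} (w : Rearr l l') : l.Perm l' := by
  induction w with
  | nil => exact .nil
  | cons a _ ih => exact .cons a ih
  | swap a b l => exact .swap b a l
  | trans _ _ ih ih' => exact .trans ih ih'

def Rearr.refl {κ : Type} : ∀ l : List κ, Rearr l l
  | [] => .nil
  | a :: l => .cons a (Rearr.refl l)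

def Rearr.map {ι κ : Type} (e : ι → κ) : ∀ {l l' : List ι}, Rearr l l' → Rearr (l.map e) (l'.map e)
  | _, _, .nil => .nil
  | _, _, .cons a w => .cons (e a) (w.map e)
  | _, _, .swap a b l => .swap (e a) (e b) (l.map e)
  | _, _, .trans w w' => .trans (w.map e) (w'.map e)

theorem listTensorMap_id {κ : Type} (X : κ → C) (l : List κ) :
    listTensorMap (fun k => 𝟙 (X k)) l = 𝟙 _ := by
  induction l with
  | nil => rfl
  | cons a l ih => simp [listTensorMap, ih]

theorem listTensorMap_comp {κ : Type} {X Y Z : κ → C} (f : ∀ k, X k ⟶ Y k) (g : ∀ k, Y k ⟶ Z k)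
    (l : List κ) : listTensorMap (fun k => f k ≫ g k) l = listTensorMap f l ≫ listTensorMap g l := by
  induction l with
  | nil => simp [listTensorMap]
  | cons a l ih => simp [listTensorMap, ih]

theorem listTensorRelabel_natural {ι κ : Type} (e : ι → κ) {Y Z : κ → C} (g : ∀ k, Y k ⟶ Z k)
    (l : List ι) : (listTensorRelabel e Y l).hom ≫ listTensorMap g (l.map e) =
      listTensorMap (fun i => g (e i)) l ≫ (listTensorRelabel e Z l).hom := by
  induction l with
  | nil => exact (Category.id_comp _).trans (Category.comp_id _).symm
  | cons a l ih =>
    change Y (e a) ◁ (listTensorRelabel e Y l).hom ≫ (g (e a) ⊗ₘ listTensorMap g (l.map e)) =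
      (g (e a) ⊗ₘ listTensorMap (fun i => g (e i)) l) ≫ Z (e a) ◁ (listTensorRelabel e Z l).hom
    rw [← id_tensorHom, ← id_tensorHom, tensorHom_comp_tensorHom, tensorHom_comp_tensorHom, ih]
    simp

section Symm

variable [SymmetricCategory C]

/-- Exchanging the first two of three factors by the braiding. -/
def swapFirst (A B Z : C) : A ⊗ (B ⊗ Z) ⟶ B ⊗ (A ⊗ Z) :=
  (α_ A B Z).inv ≫ (β_ A B).hom ▷ Z ≫ (α_ B A Z).hom

/-- A rearrangement acts on tensor products through the braiding of adjacent factors. -/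
def Rearr.hom {κ : Type} (X : κ → C) :
    ∀ {l l' : List κ}, Rearr l l' → (listTensor X l ⟶ listTensor X l')
  | _, _, .nil => 𝟙 _
  | _, _, .cons a w => X a ◁ w.hom X
  | _, _, .swap a b l => swapFirst (X a) (X b) (listTensor X l)
  | _, _, .trans w w' => w.hom X ≫ w'.hom X

theorem Rearr.hom_refl {κ : Type} (X : κ → C) (l : List κ) :
    (Rearr.refl l).hom X = 𝟙 _ := by
  induction l with
  | nil => rfl
  | cons a l ih => simp only [Rearr.refl, Rearr.hom, ih]; exact MonoidalCategory.whiskerLeft_id _ _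

theorem swapFirst_swapFirst (A B Z : C) : swapFirst A B Z ≫ swapFirst B A Z = 𝟙 _ := by
  simp [swapFirst, ← comp_whiskerRight_assoc]

theorem swapFirst_natural {A A' B B' Z Z' : C} (f : A ⟶ A') (g : B ⟶ B') (h : Z ⟶ Z') :
    (f ⊗ₘ (g ⊗ₘ h)) ≫ swapFirst A' B' Z' = swapFirst A B Z ≫ (g ⊗ₘ (f ⊗ₘ h)) := by
  simp only [swapFirst, Category.assoc]
  rw [associator_inv_naturality_assoc, ← tensorHom_id, ← tensorHom_id,
    tensorHom_comp_tensorHom_assoc, BraidedCategory.braiding_naturality, Category.comp_id,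
    ← associator_naturality, tensorHom_comp_tensorHom_assoc, Category.id_comp]

theorem swapFirst_yangBaxter (A B D Z : C) :
    swapFirst A B (D ⊗ Z) ≫ B ◁ swapFirst A D Z ≫ swapFirst B D (A ⊗ Z) =
      A ◁ swapFirst B D Z ≫ swapFirst A D (B ⊗ Z) ≫ D ◁ swapFirst A B Z := by
  have h := congrArg (fun f => f ▷ Z) (BraidedCategory.yang_baxter A B D)
  calc
    _ = 𝟙 _ ⊗≫ ((α_ A B D).inv ≫ (β_ A B).hom ▷ D ≫ (α_ B A D).hom ≫ B ◁ (β_ A D).hom ≫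
          (α_ B D A).inv ≫ (β_ B D).hom ▷ A ≫ (α_ D B A).hom) ▷ Z ⊗≫ 𝟙 _ := by
      simp only [swapFirst]; monoidal
    _ = 𝟙 _ ⊗≫ (A ◁ (β_ B D).hom ≫ (α_ A D B).inv ≫ (β_ A D).hom ▷ B ≫ (α_ D A B).hom ≫
          D ◁ (β_ A B).hom) ▷ Z ⊗≫ 𝟙 _ := by rw [h]
    _ = _ := by simp only [swapFirst]; monoidal

/-- Positions of `a` in a list, together with the list that remains. -/
inductive Del {κ : Type} (a : κ) : List κ → List κ → Type
  | here (l : List κ) : Del a (a :: l) l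
  | there (b : κ) {l l' : List κ} : Del a l l' → Del a (b :: l) (b :: l')

theorem Del.mem {κ : Type} {a : κ} {l m : List κ} (d : Del a l m) : a ∈ l := by
  induction d with
  | here => simp
  | there b _ ih => simp [ih]

def Del.hom {κ : Type} (X : κ → C) {a : κ} :
    ∀ {l m : List κ}, Del a l m → (listTensor X l ⟶ X a ⊗ listTensor X m)
  | _, _, .here _ => 𝟙 _
  | _, _, .there b d => X b ◁ d.hom X ≫ swapFirst (X b) (X a) _

theorem Del.unique {κ : Type} {a : κ} {l m m' : List κ} (hl : l.Nodup) (d : Del a l m)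
    (d' : Del a l m') : (⟨m, d⟩ : Σ m, Del a l m) = ⟨m', d'⟩ := by
  induction d generalizing m' with
  | here l =>
    cases d' with
    | here => rfl
    | there b d' => exact absurd d'.mem (List.nodup_cons.1 hl).1
  | there b d ih =>
    cases d' with
    | here => exact absurd d.mem (List.nodup_cons.1 hl).1
    | there b d' => cases ih (List.nodup_cons.1 hl).2 d'; rfl

theorem Rearr.hom_del {κ : Type} (X : κ → C) {a : κ} {l l' : List κ} (w : Rearr l l') :
    ∀ {m' : List κ} (d' : Del a l' m'), ∃ (m : List κ) (d : Del a l m) (w' : Rearr m m'),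
      w.hom X ≫ d'.hom X = d.hom X ≫ X a ◁ w'.hom X := by
  induction w with
  | nil => intro m' d'; cases d'
  | cons b w ih =>
    intro m' d'
    cases d' with
    | here => exact ⟨_, .here _, w, by simp [Rearr.hom, Del.hom]⟩
    | there b d' =>
      obtain ⟨m, d, w', h⟩ := ih d'
      refine ⟨_, .there b d, .cons b w', ?_⟩
      simp only [Rearr.hom, Del.hom, Category.assoc]
      rw [← MonoidalCategory.whiskerLeft_comp_assoc, h]
      have := swapFirst_natural (𝟙 (X b)) (𝟙 (X a)) (w'.hom X)
      simp only [id_tensorHom] at this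
      rw [← this, MonoidalCategory.whiskerLeft_comp_assoc]
  | swap b c l =>
    intro m' d'
    cases d' with
    | here =>
      refine ⟨_, .there b (.here _), Rearr.refl _, ?_⟩
      simp [Rearr.hom, Del.hom, Rearr.hom_refl]
    | there _ d' =>
      cases d' with
      | here =>
        refine ⟨_, .here _, Rearr.refl _, ?_⟩
        simp [Rearr.hom, Del.hom, Rearr.hom_refl, swapFirst_swapFirst]
      | there _ d' =>
        refine ⟨_, .there b (.there c d'), .swap b c _, ?_⟩
        have h := swapFirst_natural (𝟙 (X b)) (𝟙 (X c)) (d'.hom X)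
        simp only [id_tensorHom] at h
        simp only [Rearr.hom, Del.hom, MonoidalCategory.whiskerLeft_comp, Category.assoc]
        rw [← reassoc_of% h, swapFirst_yangBaxter]
  | trans w w' ih ih' =>
    intro m' d'
    obtain ⟨m₁, d₁, w₁, h₁⟩ := ih' d'
    obtain ⟨m₂, d₂, w₂, h₂⟩ := ih d₁
    refine ⟨_, d₂, .trans w₂ w₁, ?_⟩
    simp only [Rearr.hom, Category.assoc, h₁, MonoidalCategory.whiskerLeft_comp]
    rw [reassoc_of% h₂]

theorem Rearr.hom_nil {κ : Type} (X : κ → C) {l l' : List κ} (w : Rearr l l') (h : l = []) :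
    w.hom X = eqToHom (by have := w.perm; subst h; rw [List.nil_perm.1 this]) := by
  induction w with
  | nil => rfl
  | cons => cases h
  | swap => cases h
  | trans w w' ih ih' =>
    have := w.perm
    subst h
    simp [Rearr.hom, ih rfl, ih' (List.nil_perm.1 this)]

/-- Coherence: on a list without repetitions, the induced morphism only depends on the rearranged
list, not on the chosen word in transpositions. -/
theorem Rearr.coherence {κ : Type} (X : κ → C) {l l' : List κ} (hl : l.Nodup)
    (w w' : Rearr l l') : w.hom X = w'.hom X := by
  induction l' generalizing l with
  | nil =>
    have := List.perm_nil.1 w.perm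
    rw [w.hom_nil X this, w'.hom_nil X this]
  | cons a m ih =>
    obtain ⟨k, d, v, h⟩ := w.hom_del X (Del.here (a := a) m)
    obtain ⟨k', d', v', h'⟩ := w'.hom_del X (Del.here (a := a) m)
    cases Del.unique hl d d'
    have hm : m.Nodup := (List.nodup_cons.1 (w.perm.nodup_iff.1 hl)).2
    have := ih (v.perm.nodup_iff.2 hm) v v'
    rw [this, ← h'] at h
    have e : ∀ f : listTensor X l ⟶ listTensor X (a :: m), 
        f ≫ (Del.here (a := a) m).hom X = f := fun f => Category.comp_id f
    rwa [e, e] at h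


theorem Rearr.hom_natural {κ : Type} {X Y : κ → C} (f : ∀ k, X k ⟶ Y k) {l l' : List κ}
    (w : Rearr l l') : w.hom X ≫ listTensorMap f l' = listTensorMap f l ≫ w.hom Y := by
  induction w with
  | nil => simp [Rearr.hom]
  | cons a w ih =>
    simp only [Rearr.hom, listTensorMap]
    rw [← id_tensorHom, ← id_tensorHom, tensorHom_comp_tensorHom, tensorHom_comp_tensorHom, ih]
    simp
  | swap a b l => exact (swapFirst_natural _ _ _).symm
  | trans w w' ih ih' =>
    simp only [Rearr.hom, Category.assoc]
    rw [ih', reassoc_of% ih]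

theorem Rearr.hom_relabel {ι κ : Type} (e : ι → κ) (Y : κ → C) {l l' : List ι}
    (w : Rearr l l') : w.hom (fun i => Y (e i)) ≫ (listTensorRelabel e Y l').hom =
      (listTensorRelabel e Y l).hom ≫ (w.map e).hom Y := by
  induction w with
  | nil => simp [Rearr.hom, listTensorRelabel, Rearr.map]
  | cons a w ih =>
    simp only [Rearr.hom, listTensorRelabel, Rearr.map, whiskerLeftIso_hom]
    rw [← MonoidalCategory.whiskerLeft_comp, ← MonoidalCategory.whiskerLeft_comp, ih]
  | swap a b l =>
    have h := swapFirst_natural (𝟙 (Y (e a))) (𝟙 (Y (e b))) (listTensorRelabel e Y l).hom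
    simp only [id_tensorHom] at h
    exact h.symm
  | trans w w' ih ih' =>
    simp only [Rearr.hom, Category.assoc, Rearr.map]
    rw [ih', reassoc_of% ih]

/-- The canonical symmetry morphism between the tensor products along two orderings. On lists
without repetitions it is independent of the chosen word, by `Rearr.coherence`. -/
def permHom {κ : Type} (X : κ → C) {l l' : List κ} (h : l.Perm l') :
    listTensor X l ⟶ listTensor X l' :=
  (Rearr.nonempty_of_perm h).some.hom X

theorem permHom_eq {κ : Type} (X : κ → C) {l l' : List κ} (hl : l.Nodup) (h : l.Perm l')
    (w : Rearr l l') : permHom X h = w.hom X :=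
  Rearr.coherence X hl _ w

/-- A chosen ordering of a finite set. -/
def enum (κ : Type) [Fintype κ] : List κ := (Finset.univ : Finset κ).toList

theorem enum_nodup (κ : Type) [Fintype κ] : (enum κ).Nodup := Finset.nodup_toList _

theorem mem_enum {κ : Type} [Fintype κ] (k : κ) : k ∈ enum κ := by simp [enum]

theorem enum_perm {κ : Type} [Fintype κ] {l : List κ} (hl : l.Nodup) (h : ∀ k, k ∈ l) :
    l.Perm (enum κ) :=
  (List.perm_ext_iff_of_nodup hl (enum_nodup κ)).2 fun k => by simp [h, mem_enum]

theorem enum_map_perm {ι κ : Type} [Fintype ι] [Fintype κ] (e : ι ≃ κ) :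
    ((enum ι).map e).Perm (enum κ) :=
  enum_perm ((enum_nodup ι).map e.injective) fun k => by
    simpa using ⟨e.symm k, mem_enum _, by simp⟩

/-- The unordered tensor product `⨂_{k ∈ κ} X k` over a finite set `κ`. -/
def tensorOver {κ : Type} [Fintype κ] (X : κ → C) : C := listTensor X (enum κ)

/-- Functoriality of unordered tensor products: a bijection `e : ι ≃ κ` together with morphisms
`X i ⟶ Y (e i)` induces `⨂_{i ∈ ι} X i ⟶ ⨂_{k ∈ κ} Y k`. -/
def tensorOverMap {ι κ : Type} [Fintype ι] [Fintype κ] {X : ι → C} {Y : κ → C} (e : ι ≃ κ)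
    (f : ∀ i, X i ⟶ Y (e i)) : tensorOver X ⟶ tensorOver Y :=
  listTensorMap f (enum ι) ≫ (listTensorRelabel e Y (enum ι)).hom ≫ permHom Y (enum_map_perm e)

/-- The identity relabelling, up to rewriting the list. -/
theorem listTensorRelabel_id {κ : Type} (X : κ → C) (l : List κ) (w : Rearr (l.map id) l)
    (hl : l.Nodup) : (listTensorRelabel id X l).hom ≫ w.hom X = 𝟙 _ := by
  have key : ∀ l : List κ, ∃ w : Rearr (l.map id) l,
      (listTensorRelabel id X l).hom ≫ w.hom X = 𝟙 _ := by
    intro l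
    induction l with
    | nil => exact ⟨.nil, by simp [Rearr.hom, listTensorRelabel]⟩
    | cons a l ih =>
      obtain ⟨w, h⟩ := ih
      refine ⟨.cons a w, ?_⟩
      simp only [Rearr.hom, listTensorRelabel, whiskerLeftIso_hom]
      erw [← MonoidalCategory.whiskerLeft_comp, h]
      simp
  obtain ⟨w', h⟩ := key l
  rw [Rearr.coherence X (by simpa using hl) w w', h]

theorem listTensorRelabel_comp {ι κ τ : Type} (e : ι → κ) (e' : κ → τ) (X : τ → C) (l : List ι) :
    ∃ w : Rearr ((l.map e).map e') (l.map fun i => e' (e i)),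
      (listTensorRelabel e (fun k => X (e' k)) l).hom ≫ (listTensorRelabel e' X (l.map e)).hom ≫
        w.hom X = (listTensorRelabel (fun i => e' (e i)) X l).hom := by
  induction l with
  | nil => exact ⟨.nil, (Category.id_comp _).trans (Category.id_comp _)⟩
  | cons a l ih =>
    obtain ⟨w, h⟩ := ih
    refine ⟨.cons _ w, ?_⟩
    change X (e' (e a)) ◁ (listTensorRelabel e (fun k => X (e' k)) l).hom ≫
      X (e' (e a)) ◁ (listTensorRelabel e' X (l.map e)).hom ≫ X (e' (e a)) ◁ w.hom X =
      X (e' (e a)) ◁ (listTensorRelabel (fun i => e' (e i)) X l).hom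
    rw [← MonoidalCategory.whiskerLeft_comp, ← MonoidalCategory.whiskerLeft_comp, h]

theorem tensorOverMap_id {κ : Type} [Fintype κ] (X : κ → C) :
    tensorOverMap (Equiv.refl κ) (fun k => 𝟙 (X k)) = 𝟙 (tensorOver X) := by
  have h : ((enum κ).map id).Perm (enum κ) := by simp
  change listTensorMap (fun k => 𝟙 (X k)) (enum κ) ≫ (listTensorRelabel id X (enum κ)).hom ≫
    permHom X h = 𝟙 _
  rw [listTensorMap_id, Category.id_comp]
  exact listTensorRelabel_id X (enum κ) _ (enum_nodup κ)

theorem tensorOverMap_comp {ι κ τ : Type} [Fintype ι] [Fintype κ] [Fintype τ] {X : ι → C}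
    {Y : κ → C} {Z : τ → C} (e : ι ≃ κ) (e' : κ ≃ τ) (f : ∀ i, X i ⟶ Y (e i))
    (g : ∀ k, Y k ⟶ Z (e' k)) :
    tensorOverMap (Y := Z) (e.trans e') (fun i => f i ≫ g (e i)) =
      tensorOverMap e f ≫ tensorOverMap e' g := by
  obtain ⟨w, hw⟩ := listTensorRelabel_comp e e' Z (enum ι)
  let p := (Rearr.nonempty_of_perm (enum_map_perm e)).some
  let q := (Rearr.nonempty_of_perm (enum_map_perm e')).some
  have h₁ := p.hom_natural g
  have h₂ := p.hom_relabel e' Z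
  have h₃ := listTensorRelabel_natural e g (enum ι)
  have hn : (((enum ι).map e).map e').Nodup :=
    ((enum_nodup ι).map e.injective).map e'.injective
  have h₄ : (p.map e').hom Z ≫ q.hom Z =
      w.hom Z ≫ permHom Z (enum_map_perm (e.trans e')) :=
    Rearr.coherence Z hn ((p.map e').trans q)
      (w.trans (Rearr.nonempty_of_perm (enum_map_perm (e.trans e'))).some)
  have hc := listTensorMap_comp f (fun i => g (e i)) (enum ι)
  change listTensorMap (fun i => f i ≫ g (e i)) (enum ι) ≫
      (listTensorRelabel (fun i => e' (e i)) Z (enum ι)).hom ≫ permHom Z _ =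
    (listTensorMap f (enum ι) ≫ (listTensorRelabel e Y (enum ι)).hom ≫ p.hom Y) ≫
      listTensorMap g (enum κ) ≫ (listTensorRelabel e' Z (enum κ)).hom ≫ q.hom Z
  rw [hc, ← hw]
  simp only [Category.assoc]
  rw [reassoc_of% h₁, reassoc_of% h₂, reassoc_of% h₃, h₄]

/-- The tensor product over a one-point set is its only factor. -/
def tensorOverPUnit (X : PUnit.{1} → C) : tensorOver X ⟶ X PUnit.unit :=
  permHom X (enum_perm (l := [PUnit.unit]) (by simp) (by simp)).symm ≫ (ρ_ (X PUnit.unit)).hom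

/-- A tensor product of monoidal units is the monoidal unit. -/
def listTensorUnits {κ : Type} : ∀ l : List κ, listTensor (fun _ => 𝟙_ C) l ⟶ 𝟙_ C
  | [] => 𝟙 _
  | _ :: l => (λ_ _).hom ≫ listTensorUnits l

def tensorOverUnits (κ : Type) [Fintype κ] : tensorOver (fun _ : κ => 𝟙_ C) ⟶ 𝟙_ C :=
  listTensorUnits (enum κ)

/-- The interchange `(⨂ U k) ⊗ (⨂ V k) ⟶ ⨂ (U k ⊗ V k)`. -/
def listTensorZip {κ : Type} (U V : κ → C) :
    ∀ l : List κ, listTensor U l ⊗ listTensor V l ⟶ listTensor (fun k => U k ⊗ V k) l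
  | [] => (λ_ (𝟙_ C)).hom
  | a :: l => tensorμ (U a) (listTensor U l) (V a) (listTensor V l) ≫
      (U a ⊗ V a) ◁ listTensorZip U V l

def tensorOverZip {κ : Type} [Fintype κ] (U V : κ → C) :
    tensorOver U ⊗ tensorOver V ⟶ tensorOver (fun k => U k ⊗ V k) :=
  listTensorZip U V (enum κ)

/-- Grouping a tensor product over a disjoint union: `⨂_{(i,b)} Y (i,b) ⟶ ⨂_i ⨂_b Y (i,b)`. -/
def listTensorSigma {ι : Type} {β : ι → Type} (Y : (Σ i, β i) → C) (m : ∀ i, List (β i)) :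
    ∀ l : List ι, listTensor Y (l.sigma m) ⟶
      listTensor (fun i => listTensor (fun b => Y ⟨i, b⟩) (m i)) l
  | [] => 𝟙 _
  | i :: l => (listTensorAppend Y ((m i).map (Sigma.mk i)) (l.sigma m)).hom ≫
      ((listTensorRelabel (Sigma.mk i) Y (m i)).inv ⊗ₘ listTensorSigma Y m l)

theorem enum_sigma_perm {ι : Type} {β : ι → Type} [Fintype ι] [∀ i, Fintype (β i)] :
    ((enum ι).sigma fun i => enum (β i)).Perm (enum (Σ i, β i)) :=
  enum_perm ((enum_nodup ι).sigma fun i => enum_nodup (β i)) fun _ =>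
    List.mem_sigma.2 ⟨mem_enum _, mem_enum _⟩

def tensorOverSigma {ι : Type} {β : ι → Type} [Fintype ι] [∀ i, Fintype (β i)]
    (Y : (Σ i, β i) → C) :
    tensorOver Y ⟶ tensorOver (fun i => tensorOver fun b : β i => Y ⟨i, b⟩) :=
  permHom Y enum_sigma_perm.symm ≫ listTensorSigma Y (fun i => enum (β i)) (enum ι)

end Symm
end Tensor

/-! ### Finite sets and wreath product categories -/

/-- The category `Σ_*` of finite sets and bijections. -/
structure FinBij : Type 1 where
  carrier : Type
  [fintype : Fintype carrier]

attribute [instance] FinBij.fintype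

@[ext]
structure FinBij.Hom (S T : FinBij) where
  equiv : S.carrier ≃ T.carrier

instance FinBij.category : Category.{0} FinBij where
  Hom := FinBij.Hom
  id S := ⟨Equiv.refl S.carrier⟩
  comp f g := ⟨f.equiv.trans g.equiv⟩

/-- The one-point set `⋆`. -/
def FinBij.point : FinBij := ⟨PUnit⟩

section Wreath

universe v₁ u₁ v₂ u₂

/-- Objects of the wreath product category `Σ_* ≀ 𝒜`: finite families of objects of `𝒜`. -/
structure Wreath (𝒜 : Type u₁) : Type (max 1 u₁) where
  index : FinBij
  fam : index.carrier → 𝒜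

variable {𝒜 : Type u₁} [Category.{v₁} 𝒜] {ℬ : Type u₂} [Category.{v₂} ℬ]

/-- Morphisms of `Σ_* ≀ 𝒜`: a bijection of index sets and morphisms of `𝒜` along it. -/
structure Wreath.Hom (X Y : Wreath 𝒜) where
  base : X.index ⟶ Y.index
  app : ∀ s : X.index.carrier, X.fam s ⟶ Y.fam (base.equiv s)

instance Wreath.category : Category.{v₁} (Wreath 𝒜) where
  Hom := Wreath.Hom
  id X := ⟨𝟙 X.index, fun s => 𝟙 (X.fam s)⟩
  comp f g := ⟨f.base ≫ g.base, fun s => f.app s ≫ g.app (f.base.equiv s)⟩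
  id_comp f := by
    change Wreath.Hom.mk _ _ = Wreath.Hom.mk _ _
    congr 1
    funext s
    exact Category.id_comp (f.app s)
  comp_id f := by
    change Wreath.Hom.mk _ _ = Wreath.Hom.mk _ _
    congr 1
    funext s
    exact Category.comp_id (f.app s)
  assoc f g h := by
    congr 1
    funext s
    exact Category.assoc (f.app s) _ _

theorem Wreath.hom_ext {X Y : Wreath 𝒜} {f g : X ⟶ Y} (h : ∀ s, f.base.equiv s = g.base.equiv s)
    (h' : ∀ s, f.app s ≫ eqToHom (congrArg Y.fam (h s)) = g.app s) : f = g := by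
  obtain ⟨⟨b⟩, a⟩ := f
  obtain ⟨⟨b'⟩, a'⟩ := g
  obtain rfl : b = b' := Equiv.ext h
  have : a = a' := funext fun s => by simpa using h' s
  rw [this]

/-- The functor `Id ≀ F : Σ_* ≀ 𝒜 ⥤ Σ_* ≀ ℬ`. -/
def Wreath.map (F : 𝒜 ⥤ ℬ) : Wreath 𝒜 ⥤ Wreath ℬ where
  obj W := ⟨W.index, fun s => F.obj (W.fam s)⟩
  map f := ⟨f.base, fun s => F.map (f.app s)⟩
  map_id W := by
    change _ = Wreath.Hom.mk _ _
    congr 1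
    funext s
    exact F.map_id (W.fam s)
  map_comp f g := by
    change Wreath.Hom.mk _ _ = Wreath.Hom.mk _ _
    congr 1
    funext s
    exact F.map_comp (f.app s) _

/-- The functor `γ² : Σ_* ≀ Σ_* ⥤ Σ_*` that sends a family of finite sets to its disjoint union. -/
def coprod : Wreath FinBij ⥤ FinBij where
  obj W := ⟨Σ s, (W.fam s).carrier⟩
  map f := ⟨Equiv.sigmaCongr f.base.equiv fun s => (f.app s).equiv⟩
  map_id _ := FinBij.Hom.ext (Equiv.ext fun _ => rfl)
  map_comp _ _ := FinBij.Hom.ext (Equiv.ext fun _ => rfl)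

/-- The shape of a family of families: forget the innermost objects. -/
def Wreath.shape (W : Wreath (Wreath 𝒜)) : Wreath FinBij :=
  ⟨W.index, fun s => (W.fam s).index⟩

/-- The functor `γ² ≀ Id : (Σ_* ≀ Σ_*) ≀ 𝒜 ⥤ Σ_* ≀ 𝒜` that merges the two levels of index sets. -/
def merge : Wreath (Wreath 𝒜) ⥤ Wreath 𝒜 where
  obj W := ⟨coprod.obj W.shape, fun p => (W.fam p.1).fam p.2⟩
  map f := ⟨⟨Equiv.sigmaCongr f.base.equiv fun s => (f.app s).base.equiv⟩,
    fun p => (f.app p.1).app p.2⟩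
  map_id _ := Wreath.hom_ext (fun _ => rfl) fun _ => Category.comp_id _
  map_comp _ _ := Wreath.hom_ext (fun _ => rfl) fun _ => Category.comp_id _

/-- The functor `𝒜 ⥤ Σ_* ≀ 𝒜`, `a ↦ {a}_⋆`, that creates a new bottom vertex. -/
def singleFam : 𝒜 ⥤ Wreath 𝒜 where
  obj a := ⟨FinBij.point, fun _ => a⟩
  map f := ⟨𝟙 _, fun _ => f⟩
  map_comp f g := rfl

end Wreath

/-- `Level n` is the wreath product category `Σ_*^{≀ (n+1)} = Σ_* ≀ (⋯ ≀ (Σ_* ≀ Σ_*))`. -/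
abbrev Level : ℕ → Type 1
  | 0 => FinBij
  | n + 1 => Wreath (Level n)

instance Level.category : ∀ n, Category.{0} (Level n)
  | 0 => FinBij.category
  | n + 1 => @Wreath.category (Level n) (Level.category n)

/-- The functor `γ : Σ_*^{≀ (n+1)} ⥤ Σ_*`, which only keeps the set of leaves. -/
def gamma : ∀ n, Level n ⥤ FinBij
  | 0 => 𝟭 FinBij
  | n + 1 => Wreath.map (gamma n) ⋙ coprod

/-- The face functors `Σ_*^{≀ (n+2)} ⥤ Σ_*^{≀ (n+1)}`; the index `i = 0, …, n` composes the levels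
`i` and `i + 1`, by `Id ≀ γ² ≀ Id`. -/
def face : ∀ n, Fin (n + 1) → (Level (n + 1) ⥤ Level n)
  | 0 => fun _ => coprod
  | n + 1 => Fin.cases (merge (𝒜 := Level n)) fun i => Wreath.map (face n i)

/-- The degeneracy functors `Σ_*^{≀ (n+1)} ⥤ Σ_*^{≀ (n+2)}` that double the vertices of height
`j = 0, …, n` (the doubling of the leaves is not among them). -/
def degen : ∀ n, Fin (n + 1) → (Level n ⥤ Level (n + 1))
  | 0 => fun _ => singleFam (𝒜 := Level 0)
  | n + 1 => Fin.cases (singleFam (𝒜 := Level (n + 1))) fun j => Wreath.map (degen n j)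

/-- The canonical bijection `γ W ≅ γ (∂ᵢ W)`. -/
def gammaFace : ∀ (n : ℕ) (i : Fin (n + 1)) (W : Level (n + 1)),
    (gamma (n + 1)).obj W ⟶ (gamma n).obj ((face n i).obj W)
  | 0 => fun _ W => 𝟙 (coprod.obj W)
  | n + 1 => Fin.cases
      (fun W => ⟨(Equiv.sigmaAssoc fun (s : W.index.carrier) (t : (W.fam s).index.carrier) =>
          ((gamma n).obj ((W.fam s).fam t)).carrier).symm⟩)
      fun i W => ⟨Equiv.sigmaCongrRight fun s => (gammaFace n i (W.fam s)).equiv⟩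

/-- The canonical bijection of a set with the disjoint union of the one-element family of it. -/
def sigmaPoint (S : FinBij) : S ⟶ coprod.obj (singleFam.obj S) :=
  ⟨(Equiv.uniqueSigma fun _ : PUnit => S.carrier).symm⟩

/-- The canonical bijection `γ W ≅ γ (sⱼ W)`. -/
def gammaDegen : ∀ (n : ℕ) (j : Fin (n + 1)) (W : Level n),
    (gamma n).obj W ⟶ (gamma (n + 1)).obj ((degen n j).obj W)
  | 0 => fun _ W => sigmaPoint W
  | n + 1 => Fin.cases (fun W => sigmaPoint ((gamma (n + 1)).obj W))
      fun j W => ⟨Equiv.sigmaCongrRight fun s => (gammaDegen n j (W.fam s)).equiv⟩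

theorem Level.exists_small : ∀ n, ∃ (K : Type) (f : K → Level n),
    ∀ W, ∃ k, Nonempty (f k ≅ W)
  | 0 => by
    refine ⟨ℕ, fun n => (⟨Fin n⟩ : FinBij), fun (W : FinBij) => ⟨Fintype.card W.carrier, ⟨?_⟩⟩⟩
    let e := Fintype.equivFin W.carrier
    exact ⟨⟨e.symm⟩, ⟨e⟩, FinBij.Hom.ext (e.symm_trans_self), FinBij.Hom.ext (e.self_trans_symm)⟩
  | n + 1 => by
    obtain ⟨K, f, hf⟩ := Level.exists_small n
    refine ⟨Σ m : ℕ, (Fin m → K), fun p => (⟨⟨Fin p.1⟩, fun i => f (p.2 i)⟩ : Wreath (Level n)),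
      fun (W : Wreath (Level n)) => ?_⟩
    let e := Fintype.equivFin W.index.carrier
    choose k hk using fun i => hf (W.fam (e.symm i))
    refine ⟨⟨Fintype.card W.index.carrier, k⟩, ⟨?_⟩⟩
    let φ i := (hk i).some
    refine ⟨⟨⟨e.symm⟩, fun i => (φ i).hom⟩,
      ⟨⟨e⟩, fun s => eqToHom (by simp) ≫ (φ (e s)).inv⟩, ?_, ?_⟩
    · refine Wreath.hom_ext (fun s => e.apply_symm_apply s) fun s => ?_
      have key : ∀ (s t : Fin (Fintype.card W.index.carrier)) (h : t = s),
          ((φ s).hom ≫ eqToHom (by rw [h]) ≫ (φ t).inv) ≫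
            eqToHom (congrArg (fun i => f (k i)) h) = 𝟙 (f (k s)) := by
        rintro s _ rfl
        simp
      exact key s _ (e.apply_symm_apply s)
    · refine Wreath.hom_ext (fun s => e.symm_apply_apply s) fun s => ?_
      have h := congrArg W.fam (e.symm_apply_apply s)
      have key : ((eqToHom h.symm ≫ (φ (e s)).inv) ≫ (φ (e s)).hom) ≫ eqToHom h =
          𝟙 (W.fam s) := by simp
      exact key

instance Level.essentiallySmall (n : ℕ) : EssentiallySmall.{0} (Level n) := by
  obtain ⟨K, f, hf⟩ := Level.exists_small n
  refine (essentiallySmall_iff _).2 ⟨small_of_surjective (f := fun k => toSkeleton (f k)) ?_,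
    inferInstance⟩
  intro W
  obtain ⟨k, ⟨e⟩⟩ := hf ((fromSkeleton _).obj W)
  exact ⟨k, (toSkeleton_eq_iff.2 ⟨e⟩).trans (by simp)⟩


/-! ### Composition products of symmetric sequences -/

section Sequences

variable (C : Type u) [Category.{v} C]

/-- Symmetric sequences in `C`: functors `Σ_* ⥤ C`. -/
abbrev SymSeq := FinBij ⥤ C

variable {C}

section Kan

variable [HasLimitsOfSize.{0, 0} C]

instance hasRightKanExtension (n : ℕ) (F : Level n ⥤ C) :
    (gamma n).HasRightKanExtension F := by
  have (S : FinBij) : HasLimitsOfShape (StructuredArrow S (gamma n)) C :=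
    hasLimitsOfShape_of_equivalence (equivSmallModel.{0} (StructuredArrow S (gamma n))).symm
  infer_instance

/-- The right Kan extension `R_γ F : Σ_* ⥤ C` of `F : Σ_*^{≀ (n+1)} ⥤ C` along `γ`. -/
def kan (n : ℕ) (F : Level n ⥤ C) : SymSeq C := (gamma n).rightKanExtension F

/-- The universal transformation `ι : (R_γ F) γ ⟶ F`. -/
def kanCounit (n : ℕ) (F : Level n ⥤ C) : gamma n ⋙ kan n F ⟶ F :=
  (gamma n).rightKanExtensionCounit F

end Kan

variable [MonoidalCategory C] [SymmetricCategory C]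

universe v₁ u₁

section Odot

variable {𝒜 : Type u₁} [Category.{v₁} 𝒜]

/-- The product `A ⊚ B : Σ_* ≀ 𝒜 ⥤ C`, `{a_s}_{s ∈ S} ↦ A(S) ⊗ ⨂_{s ∈ S} B(a_s)`. -/
def odot (A : SymSeq C) (B : 𝒜 ⥤ C) : Wreath 𝒜 ⥤ C where
  obj W := A.obj W.index ⊗ tensorOver fun s : W.index.carrier => B.obj (W.fam s)
  map f := A.map f.base ⊗ₘ tensorOverMap f.base.equiv fun s => B.map (f.app s)
  map_id W := by
    have h : (tensorOverMap (Equiv.refl W.index.carrier) fun s => B.map (𝟙 (W.fam s))) = 𝟙 _ := by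
      simp only [B.map_id]
      exact tensorOverMap_id _
    have h' : A.map (𝟙 W.index) = 𝟙 _ := A.map_id _
    exact (congrArg₂ (fun a b => a ⊗ₘ b) h' h).trans (id_tensorHom_id _ _)
  map_comp {X Y Z} f g := by
    have h := tensorOverMap_comp (X := fun s => B.obj (X.fam s)) (Y := fun s => B.obj (Y.fam s))
      (Z := fun s => B.obj (Z.fam s)) f.base.equiv g.base.equiv (fun s => B.map (f.app s))
      (fun s => B.map (g.app s))
    rw [tensorHom_comp_tensorHom, ← A.map_comp, ← h]
    exact congrArg (fun t => A.map (f.base ≫ g.base) ⊗ₘ tensorOverMap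
      (X := fun s => B.obj (X.fam s)) (Y := fun s => B.obj (Z.fam s))
      (f.base.equiv.trans g.base.equiv) t) (funext fun s => B.map_comp (f.app s) _)

/-- `Id ⊚ f` at an object `W` of a wreath product, for a family of morphisms
`f s : b_s ⟶ b'_s` between objects of `C` indexed by the index set of `W`. -/
def odotWhisker (A : SymSeq C) {S : FinBij} {b b' : S.carrier → C} (f : ∀ s, b s ⟶ b' s) :
    A.obj S ⊗ tensorOver b ⟶ A.obj S ⊗ tensorOver b' :=
  A.obj S ◁ tensorOverMap (Equiv.refl S.carrier) f

/-- The associativity `(A ⊚ A') ⊚ B ⟶ A ⊚ (A' ⊚ B)` of `⊚`, at an object of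
`Σ_* ≀ (Σ_* ≀ 𝒜)`. -/
def odotAssoc (A A' : SymSeq C) (B : 𝒜 ⥤ C) (W : Wreath (Wreath 𝒜)) :
    (odot A A').obj W.shape ⊗
        tensorOver (fun p : Σ s, (W.fam s).index.carrier => B.obj ((W.fam p.1).fam p.2)) ⟶
      (odot A (odot A' B)).obj W :=
  (α_ (A.obj W.index) _ _).hom ≫
    A.obj W.index ◁ (_ ◁ tensorOverSigma _ ≫ tensorOverZip _ _)

/-- The transformation `Δ̃ ≀ Id : (A ⊚ B)(γ² ≀ Id) ⟶ A ⊚ A ⊚ B` at an object of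
`Σ_* ≀ (Σ_* ≀ 𝒜)`, which applies a cocomposition `Δ̃` to the lowest level. -/
def cocompBottom {A : SymSeq C} (Δ : coprod ⋙ A ⟶ odot A A) (B : 𝒜 ⥤ C)
    (W : Wreath (Wreath 𝒜)) :
    (odot A B).obj (merge.obj W) ⟶ (odot A (odot A B)).obj W :=
  Δ.app W.shape ▷ _ ≫ odotAssoc A A B W

end Odot

variable [HasLimitsOfSize.{0, 0} C]

variable (C) in
/-- The counit symmetric sequence: the monoidal unit on one-element sets and the final object
on all other finite sets. -/
def counitSeq : SymSeq C where
  obj T := if Fintype.card T.carrier = 1 then 𝟙_ C else ⊤_ C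
  map f := eqToHom (by rw [Fintype.card_congr f.equiv])

/-- The value of the counit sequence on the one-point set is the monoidal unit. -/
def counitSeqPoint : (counitSeq C).obj FinBij.point ⟶ 𝟙_ C :=
  eqToHom (if_pos (t := 𝟙_ C) (e := ⊤_ C) (c := Fintype.card PUnit.{1} = 1) Fintype.card_punit)

section Counit

variable {𝒜 : Type u₁} [Category.{v₁} 𝒜]

/-- The transformation `(A ⊚ B) s₀ ⟶ (𝟙 ⊚ B) s₀ = B` induced by a counit `ε̃ : A ⟶ 𝟙`. -/
def counitBottom {A : SymSeq C} (ε : A ⟶ counitSeq C) (B : 𝒜 ⥤ C) (a : 𝒜) :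
    (odot A B).obj (singleFam.obj a) ⟶ B.obj a :=
  ((ε.app FinBij.point ≫ counitSeqPoint) ⊗ₘ tensorOverPUnit fun _ => B.obj a) ≫
    (λ_ (B.obj a)).hom

end Counit

/-- The canonical bijection between the two iterated disjoint unions of a family of families of
finite sets (both of which are `γ³`). -/
def coprodAssoc (W : Wreath (Wreath FinBij)) :
    coprod.obj ((Wreath.map coprod).obj W) ⟶ coprod.obj (merge.obj W) :=
  ⟨(Equiv.sigmaAssoc fun (s : W.index.carrier) (t : (W.fam s).index.carrier) =>
    ((W.fam s).fam t).carrier).symm⟩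

/-- The compatibility of a left coaction `Δ̃_M : M γ² ⟶ A ⊚ M` with the cocomposition
`Δ̃ : A γ² ⟶ A ⊚ A`: both ways from `M γ³` to `A ⊚ A ⊚ M` agree. -/
def IsCoassociative {A M : SymSeq C} (Δ : coprod ⋙ A ⟶ odot A A) (ΔM : coprod ⋙ M ⟶ odot A M) :
    Prop :=
  ∀ W : Wreath (Wreath FinBij),
    M.map (coprodAssoc W) ≫ ΔM.app (merge.obj W) ≫ cocompBottom Δ M W =
      ΔM.app ((Wreath.map coprod).obj W) ≫ odotWhisker A fun s => ΔM.app (W.fam s)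

/-- The compatibility of a left coaction with the counit `ε̃ : A ⟶ 𝟙` and `s₀`. -/
def IsLeftCounital {A M : SymSeq C} (ε : A ⟶ counitSeq C) (ΔM : coprod ⋙ M ⟶ odot A M) : Prop :=
  ∀ S : FinBij,
    M.map (sigmaPoint S) ≫ ΔM.app (singleFam.obj S) ≫ counitBottom ε M S = 𝟙 (M.obj S)

/-- The canonical bijection of a set with the disjoint union of one-point sets indexed by it. -/
def sigmaPoints (S : FinBij) : S ⟶ coprod.obj ⟨S, fun _ => FinBij.point⟩ :=
  ⟨(Equiv.sigmaPUnit S.carrier).symm⟩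

/-- The compatibility of a cocomposition with the counit `ε̃ : A ⟶ 𝟙` and `s₁`. -/
def IsRightCounital {A : SymSeq C} (ε : A ⟶ counitSeq C) (Δ : coprod ⋙ A ⟶ odot A A) : Prop :=
  ∀ S : FinBij,
    A.map (sigmaPoints S) ≫ Δ.app ⟨S, fun _ => FinBij.point⟩ ≫
      (odotWhisker A (S := S) fun _ => ε.app FinBij.point ≫ counitSeqPoint) ≫
      A.obj S ◁ tensorOverUnits S.carrier ≫ (ρ_ (A.obj S)).hom = 𝟙 (A.obj S)

variable (C) in
/-- Counital cooperads in `C`. -/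
structure Cooperad where
  seq : SymSeq C
  cocomp : coprod ⋙ seq ⟶ odot seq seq
  counit : seq ⟶ counitSeq C
  coassoc : IsCoassociative cocomp cocomp
  left_counit : IsLeftCounital counit cocomp
  right_counit : IsRightCounital counit cocomp

/-- Left comodules over a counital cooperad. -/
structure LeftComodule (O : Cooperad C) where
  seq : SymSeq C
  coact : coprod ⋙ seq ⟶ odot O.seq seq
  coassoc : IsCoassociative O.cocomp coact
  left_counit : IsLeftCounital O.counit coact

variable {O : Cooperad C} (M : LeftComodule O)

namespace LeftComodule

/-- The functor `O ⊚ ⋯ ⊚ O ⊚ M : Σ_*^{≀ (n+1)} ⥤ C` with `n` factors `O`. -/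
def iter : ∀ n, Level n ⥤ C
  | 0 => M.seq
  | n + 1 => odot O.seq (iter n)

/-- `Δ̃ᵢ : (O^{⊚ n} ⊚ M) ∂ᵢ ⟶ O^{⊚ (n+1)} ⊚ M` at an object: apply the cocomposition of `O` (or,
at the top level `i = n`, the coaction of `M`) at level `i`. -/
def cofaceApp : ∀ (n : ℕ) (i : Fin (n + 1)) (W : Level (n + 1)),
    (M.iter n).obj ((face n i).obj W) ⟶ (M.iter (n + 1)).obj W
  | 0 => fun _ W => M.coact.app W
  | n + 1 => Fin.cases (fun W => cocompBottom O.cocomp (M.iter n) W)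
      fun i W => odotWhisker O.seq (S := W.index) fun s => cofaceApp n i (W.fam s)

/-- `ε̃ⱼ : (O^{⊚ (n+1)} ⊚ M) sⱼ ⟶ O^{⊚ n} ⊚ M` at an object: apply the counit of `O` at
level `j`. -/
def codegenApp : ∀ (n : ℕ) (j : Fin (n + 1)) (W : Level n),
    (M.iter (n + 1)).obj ((degen n j).obj W) ⟶ (M.iter n).obj W
  | 0 => fun _ W => counitBottom O.counit (M.iter 0) W
  | n + 1 => Fin.cases (fun W => counitBottom O.counit (M.iter (n + 1)) W)
      fun j W => odotWhisker O.seq (S := W.index) fun s => codegenApp n j (W.fam s)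

/-- The symmetric sequence `O ∘̂ ⋯ ∘̂ O ∘̂ M` with `n` factors `O`: the right Kan extension of
`O^{⊚ n} ⊚ M` along `γ`. For `n = 0` it is `M`, as `γ` is then the identity functor. -/
def compProd : ℕ → SymSeq C
  | 0 => M.seq
  | n + 1 => kan (n + 1) (M.iter (n + 1))

/-- The universal transformation `ι : (O^{∘̂ n} ∘̂ M) γ ⟶ O^{⊚ n} ⊚ M`. -/
def iota : ∀ n, gamma n ⋙ M.compProd n ⟶ M.iter n
  | 0 => (Functor.leftUnitor M.seq).hom
  | n + 1 => kanCounit (n + 1) (M.iter (n + 1))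

/-- `d : O^{∘̂ n} ∘̂ M ⟶ O^{∘̂ (n+1)} ∘̂ M` is the map induced on right Kan extensions
by `Δ̃ᵢ`. -/
def IsCoface (n : ℕ) (i : Fin (n + 1)) (d : M.compProd n ⟶ M.compProd (n + 1)) : Prop :=
  ∀ W : Level (n + 1), d.app ((gamma (n + 1)).obj W) ≫ (M.iota (n + 1)).app W =
    (M.compProd n).map (gammaFace n i W) ≫ (M.iota n).app ((face n i).obj W) ≫ M.cofaceApp n i W

/-- `s : O^{∘̂ (n+1)} ∘̂ M ⟶ O^{∘̂ n} ∘̂ M` is the map induced on right Kan extensions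
by `ε̃ⱼ`. -/
def IsCodegen (n : ℕ) (j : Fin (n + 1)) (s : M.compProd (n + 1) ⟶ M.compProd n) : Prop :=
  ∀ W : Level n, s.app ((gamma n).obj W) ≫ (M.iota n).app W =
    (M.compProd (n + 1)).map (gammaDegen n j W) ≫ (M.iota (n + 1)).app ((degen n j).obj W) ≫
      M.codegenApp n j W

end LeftComodule

end Sequences

/-- An extra codegeneracy (below the codegeneracy `σ 0`) of a coaugmented cosimplicial object. -/
structure ExtraCodegeneracy {D : Type u} [Category.{v} D]
    (X : CosimplicialObject.Augmented D) where
  s' : X.right.obj (.mk 0) ⟶ X.left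
  s : ∀ n : ℕ, X.right.obj (.mk (n + 1)) ⟶ X.right.obj (.mk n)
  aug_s' : X.hom.app (.mk 0) ≫ s' = 𝟙 X.left
  δ_one_s : X.right.δ 1 ≫ s 0 = s' ≫ X.hom.app (.mk 0)
  δ_zero_s : ∀ n : ℕ, X.right.δ 0 ≫ s n = 𝟙 _
  δ_succ_s : ∀ (n : ℕ) (i : Fin (n + 2)), X.right.δ i.succ ≫ s (n + 1) = s n ≫ X.right.δ i
  σ_zero_s' : X.right.σ 0 ≫ s' = s 0 ≫ s'
  σ_zero_s : ∀ n : ℕ, X.right.σ 0 ≫ s n = s (n + 1) ≫ s n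
  σ_succ_s : ∀ (n : ℕ) (i : Fin (n + 1)), X.right.σ i.succ ≫ s n = s (n + 1) ≫ X.right.σ i

end CooperadComplex

end

open CooperadComplex

/-!
The comultiplication, the counit and the coaction act at the level of the wreath categories, and a
natural transformation into a right Kan extension along `gamma n` is determined by its composition
with the universal transformation. Hence every identity between the `Δᵢ` and `εⱼ` follows from the
corresponding identity between families of morphisms indexed by the objects of `Level n`. By
induction on `n` these identities reduce to the ones that involve the outermost factor, where they
are coassociativity and counitality up to rearranging tensor factors. The rearrangements commute
with everything in sight because any two morphisms obtained from the structure isomorphisms of `C`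
by permuting the same pairwise distinct factors are equal.

The cosimplicial identities then suffice because the simplex category is presented by the cofaces
and codegeneracies. In the category with this presentation a morphism whose image misses `i` factors
through `δ i`, and a surjective one is a composition of codegeneracies, which has a normal form
determined by the underlying map.
-/

noncomputable section

namespace CooperadComplex

universe v u v₁ u₁ v₂ u₂

/-! ### Canonical morphisms between tensor products -/

/-- The reverse of a rearrangement. -/
def Rearr.symm {κ : Type} : ∀ {l l' : List κ}, Rearr l l' → Rearr l' l
  | _, _, .nil => .nil
  | _, _, .cons a w => .cons a w.symm
  | _, _, .swap a b l => .swap b a l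
  | _, _, .trans w w' => .trans w'.symm w.symm

/-- A rearrangement of `m`, applied to the end of `l ++ m`. -/
def Rearr.appendLeft {κ : Type} {m m' : List κ} (w : Rearr m m') :
    ∀ l : List κ, Rearr (l ++ m) (l ++ m')
  | [] => w
  | a :: l => .cons a (w.appendLeft l)

/-- A rearrangement of `l`, applied to the beginning of `l ++ m`. -/
def Rearr.appendRight {κ : Type} (m : List κ) :
    ∀ {l l' : List κ}, Rearr l l' → Rearr (l ++ m) (l' ++ m)
  | _, _, .nil => Rearr.refl m
  | _, _, .cons a w => .cons a (w.appendRight m)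
  | _, _, .swap a b l => .swap a b (l ++ m)
  | _, _, .trans w w' => .trans (w.appendRight m) (w'.appendRight m)

section Pres

variable {C : Type u} [Category.{v} C] [MonoidalCategory C]

/-- A presentation of an object as the tensor product of the objects `Z t` along a word. -/
structure Pres {τ : Type} (Z : τ → C) (A : C) where
  word : List τ
  iso : A ≅ listTensor Z word

variable {τ : Type} {Z : τ → C}

namespace Pres

/-- The presentation of the unit object by the empty word. -/
def unit {τ : Type} (Z : τ → C) : Pres Z (𝟙_ C) := ⟨[], Iso.refl _⟩

/-- The presentation of `Z t` by the one-letter word `t`. -/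
def leaf {τ : Type} (Z : τ → C) (t : τ) : Pres Z (Z t) := ⟨[t], (ρ_ (Z t)).symm⟩

/-- The presentation of a tensor product by the concatenation of words. -/
def tensor {A B : C} (p : Pres Z A) (q : Pres Z B) : Pres Z (A ⊗ B) :=
  ⟨p.word ++ q.word, (p.iso ⊗ᵢ q.iso) ≪≫ (listTensorAppend Z p.word q.word).symm⟩

/-- The presentation of a tensor product along a list by the concatenation of words. -/
def ofList {κ : Type} {X : κ → C} (p : ∀ k, Pres Z (X k)) :
    ∀ l : List κ, Pres Z (listTensor X l)
  | [] => unit Z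
  | a :: l => (p a).tensor (ofList p l)

/-- The presentation of an unordered tensor product induced by presentations of its factors. -/
def all {κ : Type} [Fintype κ] {X : κ → C} (p : ∀ k, Pres Z (X k)) : Pres Z (tensorOver X) :=
  ofList p (enum κ)

theorem word_leaf (t : τ) : (leaf Z t).word = [t] := rfl

theorem word_ofList {κ : Type} {X : κ → C} (p : ∀ k, Pres Z (X k)) (l : List κ) :
    (ofList p l).word = l.flatMap fun k => (p k).word := by
  induction l with
  | nil => rfl
  | cons a l ih => simp [ofList, tensor, ih]

variable {κ : Type} [Fintype κ]

theorem word_all {X : κ → C} (p : ∀ k, Pres Z (X k)) :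
    (all p).word = (enum κ).flatMap fun k => (p k).word :=
  word_ofList p _

theorem word_all_unit : (all fun _ : κ => unit Z).word = [] :=
  (word_all _).trans (List.flatMap_eq_nil_iff.2 fun _ _ => rfl)

theorem word_all_leaf (φ : κ → τ) : (all fun k => leaf Z (φ k)).word = (enum κ).map φ := by
  simp only [word_all, word_leaf, List.map_eq_flatMap]

theorem not_mem_word_all_leaf {φ : κ → τ} {t : τ} (h : ∀ k, φ k ≠ t) :
    t ∉ (all fun k => leaf Z (φ k)).word := by
  rw [word_all_leaf]
  simpa only [List.mem_map, not_exists, not_and] using fun k _ => h k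

theorem nodup_word_all_leaf {φ : κ → τ} (hφ : Function.Injective φ) :
    (all fun k => leaf Z (φ k)).word.Nodup := by
  rw [word_all_leaf]
  exact (enum_nodup κ).map hφ

theorem nodup_word_tensor_all_leaf {A : C} {p : Pres Z A} {φ : κ → τ} (hp : p.word.Nodup)
    (hφ : Function.Injective φ) (h : ∀ k, φ k ∉ p.word) :
    (p.tensor (all fun k => leaf Z (φ k))).word.Nodup := by
  refine hp.append (nodup_word_all_leaf hφ) ?_
  rw [word_all_leaf]
  simp only [List.disjoint_right, List.mem_map, forall_exists_index, and_imp]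
  rintro _ k - rfl
  exact h k

end Pres

end Pres

section IsCanon

variable {C : Type u} [Category.{v} C] [MonoidalCategory C] [SymmetricCategory C]

theorem Rearr.hom_symm {κ : Type} (X : κ → C) {l l' : List κ} (w : Rearr l l') :
    w.hom X ≫ w.symm.hom X = 𝟙 _ ∧ w.symm.hom X ≫ w.hom X = 𝟙 _ := by
  induction w with
  | nil => simp [Rearr.hom, Rearr.symm]
  | cons a w ih =>
    simp only [Rearr.hom, Rearr.symm]
    rw [← MonoidalCategory.whiskerLeft_comp, ← MonoidalCategory.whiskerLeft_comp, ih.1, ih.2]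
    simp
  | swap a b l => exact ⟨swapFirst_swapFirst _ _ _, swapFirst_swapFirst _ _ _⟩
  | trans w w' ih ih' =>
    simp only [Rearr.hom, Rearr.symm, Category.assoc]
    constructor
    · rw [reassoc_of% ih'.1, ih.1]
    · rw [reassoc_of% ih.2, ih'.2]

theorem Rearr.hom_appendLeft {κ : Type} (X : κ → C) {m m' : List κ} (w : Rearr m m')
    (l : List κ) : (w.appendLeft l).hom X ≫ (listTensorAppend X l m').hom =
      (listTensorAppend X l m).hom ≫ listTensor X l ◁ w.hom X := by
  induction l with
  | nil => simp [Rearr.appendLeft, listTensorAppend]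
  | cons a l ih =>
    simp only [Rearr.appendLeft, Rearr.hom, listTensorAppend, Iso.trans_hom, whiskerLeftIso_hom,
      Iso.symm_hom, Category.assoc]
    erw [← MonoidalCategory.whiskerLeft_comp_assoc, ih]
    simp

theorem Rearr.hom_appendRight {κ : Type} (X : κ → C) {l l' : List κ} (w : Rearr l l')
    (m : List κ) : (w.appendRight m).hom X ≫ (listTensorAppend X l' m).hom =
      (listTensorAppend X l m).hom ≫ w.hom X ▷ listTensor X m := by
  induction w with
  | nil => simp [Rearr.appendRight, Rearr.hom, Rearr.hom_refl]
  | cons a w ih =>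
    simp only [Rearr.appendRight, Rearr.hom, listTensorAppend, Iso.trans_hom, whiskerLeftIso_hom,
      Iso.symm_hom, Category.assoc]
    erw [← MonoidalCategory.whiskerLeft_comp_assoc, ih]
    simp
  | swap a b l =>
    have h := swapFirst_natural (𝟙 (X a)) (𝟙 (X b)) (listTensorAppend X l m).hom
    simp only [id_tensorHom] at h
    simp only [Rearr.appendRight, Rearr.hom, listTensorAppend, Iso.trans_hom, whiskerLeftIso_hom,
      Iso.symm_hom, Category.assoc, MonoidalCategory.whiskerLeft_comp]
    erw [← reassoc_of% h]
    simp only [swapFirst]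
    congr 1
    monoidal
  | trans w w' ih ih' =>
    simp only [Rearr.appendRight, Rearr.hom, Category.assoc, comp_whiskerRight]
    rw [ih', reassoc_of% ih]

theorem exists_rearr_append_nil {κ : Type} (X : κ → C) (l : List κ) :
    ∃ w : Rearr (l ++ []) l, (listTensorAppend X l []).hom ≫ (ρ_ _).hom = w.hom X := by
  induction l with
  | nil => exact ⟨.nil, by
    change (λ_ (𝟙_ C)).inv ≫ (ρ_ (𝟙_ C)).hom = 𝟙 _
    rw [← unitors_equal, Iso.inv_hom_id]⟩
  | cons a l ih =>
    obtain ⟨w, h⟩ := ih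
    refine ⟨.cons a w, ?_⟩
    simp only [listTensorAppend, Rearr.hom, ← h]
    simp

theorem exists_rearr_append_assoc {κ : Type} (X : κ → C) (l m n : List κ) :
    ∃ w : Rearr ((l ++ m) ++ n) (l ++ (m ++ n)),
      (listTensorAppend X (l ++ m) n).hom ≫ (listTensorAppend X l m).hom ▷ _ ≫ (α_ _ _ _).hom =
        w.hom X ≫ (listTensorAppend X l (m ++ n)).hom ≫ _ ◁ (listTensorAppend X m n).hom := by
  induction l with
  | nil => exact ⟨Rearr.refl _, by simp [listTensorAppend, Rearr.hom_refl]⟩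
  | cons a l ih =>
    obtain ⟨w, h⟩ := ih
    refine ⟨.cons a w, ?_⟩
    have h' := congrArg (fun f => X a ◁ f) h
    simp only [MonoidalCategory.whiskerLeft_comp] at h'
    change (X a ◁ (listTensorAppend X (l ++ m) n).hom ≫ (α_ _ _ _).inv) ≫
        (X a ◁ (listTensorAppend X l m).hom ≫ (α_ _ _ _).inv) ▷ _ ≫ (α_ _ _ _).hom =
      X a ◁ w.hom X ≫ (X a ◁ (listTensorAppend X l (m ++ n)).hom ≫ (α_ _ _ _).inv) ≫
        (X a ⊗ listTensor X l) ◁ (listTensorAppend X m n).hom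
    calc
      _ = (X a ◁ (listTensorAppend X (l ++ m) n).hom ≫
          X a ◁ (listTensorAppend X l m).hom ▷ _ ≫ X a ◁ (α_ _ _ _).hom) ≫ (α_ _ _ _).inv := by
        simp
      _ = _ := by rw [h']; simp

variable {τ : Type} {Z : τ → C}

/-- A morphism between presented objects is canonical if it is induced by a rearrangement of
the presenting words. -/
def IsCanon {A B : C} (p : Pres Z A) (q : Pres Z B) (f : A ⟶ B) : Prop :=
  ∃ w : Rearr p.word q.word, f = p.iso.hom ≫ w.hom Z ≫ q.iso.inv

namespace IsCanon

variable {A B D E : C} {p : Pres Z A} {q : Pres Z B} {r : Pres Z D} {r' : Pres Z E}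

theorem unique (hp : p.word.Nodup) {f g : A ⟶ B} (hf : IsCanon p q f) (hg : IsCanon p q g) :
    f = g := by
  obtain ⟨w, rfl⟩ := hf
  obtain ⟨w', rfl⟩ := hg
  rw [Rearr.coherence Z hp w w']

protected theorem id (p : Pres Z A) : IsCanon p p (𝟙 A) :=
  ⟨Rearr.refl _, by simp [Rearr.hom_refl]⟩

protected theorem comp {f : A ⟶ B} {g : B ⟶ D} (hf : IsCanon p q f) (hg : IsCanon q r g) :
    IsCanon p r (f ≫ g) := by
  obtain ⟨w, rfl⟩ := hf
  obtain ⟨w', rfl⟩ := hg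
  exact ⟨w.trans w', by simp [Rearr.hom]⟩

protected theorem inv {f : A ≅ B} (hf : IsCanon p q f.hom) : IsCanon q p f.inv := by
  obtain ⟨w, hw⟩ := hf
  refine ⟨w.symm, ?_⟩
  rw [← cancel_epi f.hom, f.hom_inv_id, hw]
  simp [reassoc_of% (w.hom_symm Z).1]

protected theorem whiskerLeft (p : Pres Z A) {f : B ⟶ D} (hf : IsCanon q r f) :
    IsCanon (p.tensor q) (p.tensor r) (A ◁ f) := by
  obtain ⟨w, rfl⟩ := hf
  refine ⟨w.appendLeft p.word, ?_⟩
  change _ = ((p.iso.hom ⊗ₘ q.iso.hom) ≫ (listTensorAppend Z _ _).inv) ≫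
    (w.appendLeft p.word).hom Z ≫ (listTensorAppend Z _ _).hom ≫ (p.iso.inv ⊗ₘ r.iso.inv)
  rw [reassoc_of% w.hom_appendLeft Z p.word, Category.assoc, Iso.inv_hom_id_assoc, ← id_tensorHom,
    ← id_tensorHom, tensorHom_comp_tensorHom, tensorHom_comp_tensorHom]
  simp

protected theorem whiskerRight {f : A ⟶ B} (hf : IsCanon p q f) (r : Pres Z D) :
    IsCanon (p.tensor r) (q.tensor r) (f ▷ D) := by
  obtain ⟨w, rfl⟩ := hf
  refine ⟨w.appendRight r.word, ?_⟩
  change _ = ((p.iso.hom ⊗ₘ r.iso.hom) ≫ (listTensorAppend Z _ _).inv) ≫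
    (w.appendRight r.word).hom Z ≫ (listTensorAppend Z _ _).hom ≫ (q.iso.inv ⊗ₘ r.iso.inv)
  rw [reassoc_of% w.hom_appendRight Z r.word, Category.assoc, Iso.inv_hom_id_assoc,
    ← tensorHom_id, ← tensorHom_id, tensorHom_comp_tensorHom, tensorHom_comp_tensorHom]
  simp

protected theorem tensor {f : A ⟶ B} {g : D ⟶ E} (hf : IsCanon p q f) (hg : IsCanon r r' g) :
    IsCanon (p.tensor r) (q.tensor r') (f ⊗ₘ g) := by
  rw [MonoidalCategory.tensorHom_def]
  exact (hf.whiskerRight r).comp (IsCanon.whiskerLeft q hg)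

protected theorem leftUnitor (p : Pres Z A) : IsCanon ((Pres.unit Z).tensor p) p (λ_ A).hom := by
  refine ⟨Rearr.refl _, ?_⟩
  simp [Pres.tensor, Pres.unit, listTensorAppend, Rearr.hom_refl]

protected theorem rightUnitor (p : Pres Z A) : IsCanon (p.tensor (Pres.unit Z)) p (ρ_ A).hom := by
  obtain ⟨w, h⟩ := exists_rearr_append_nil Z p.word
  refine ⟨w, ?_⟩
  change _ = ((p.iso.hom ⊗ₘ 𝟙 _) ≫ (listTensorAppend Z _ _).inv) ≫ w.hom Z ≫ p.iso.inv
  rw [← h]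
  simp

protected theorem associator (p : Pres Z A) (q : Pres Z B) (r : Pres Z D) :
    IsCanon ((p.tensor q).tensor r) (p.tensor (q.tensor r)) (α_ A B D).hom := by
  obtain ⟨w, h⟩ := exists_rearr_append_assoc Z p.word q.word r.word
  refine ⟨w, ?_⟩
  change _ = ((((p.iso.hom ⊗ₘ q.iso.hom) ≫ (listTensorAppend Z _ _).inv) ⊗ₘ r.iso.hom) ≫
      (listTensorAppend Z _ _).inv) ≫ w.hom Z ≫ (listTensorAppend Z _ _).hom ≫
      (p.iso.inv ⊗ₘ ((listTensorAppend Z _ _).hom ≫ (q.iso.inv ⊗ₘ r.iso.inv)))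
  have e : p.iso.inv ⊗ₘ ((listTensorAppend Z q.word r.word).hom ≫ (q.iso.inv ⊗ₘ r.iso.inv)) =
      _ ◁ (listTensorAppend Z q.word r.word).hom ≫ (p.iso.inv ⊗ₘ (q.iso.inv ⊗ₘ r.iso.inv)) := by
    rw [← id_tensorHom, tensorHom_comp_tensorHom, Category.id_comp]
  rw [e, ← reassoc_of% h, Category.assoc, Iso.inv_hom_id_assoc, ← tensorHom_id,
    tensorHom_comp_tensorHom_assoc, ← associator_naturality, tensorHom_comp_tensorHom_assoc]
  simp

theorem braiding_leaf_leaf (s t : τ) :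
    IsCanon ((Pres.leaf Z s).tensor (Pres.leaf Z t)) ((Pres.leaf Z t).tensor (Pres.leaf Z s))
      (β_ (Z s) (Z t)).hom := by
  refine ⟨.swap s t [], ?_⟩
  have key : ((ρ_ (Z s)).inv ⊗ₘ (ρ_ (Z t)).inv) ≫ (α_ (Z s) (𝟙_ C) (Z t ⊗ 𝟙_ C)).hom ≫
      Z s ◁ (λ_ (Z t ⊗ 𝟙_ C)).hom = Z s ◁ (ρ_ (Z t)).inv := by
    rw [MonoidalCategory.tensorHom_def]
    monoidal
  have key' : Z t ◁ (λ_ (Z s ⊗ 𝟙_ C)).inv ≫ (α_ (Z t) (𝟙_ C) (Z s ⊗ 𝟙_ C)).inv ≫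
      ((ρ_ (Z t)).hom ⊗ₘ (ρ_ (Z s)).hom) = Z t ◁ (ρ_ (Z s)).hom := by
    rw [MonoidalCategory.tensorHom_def]
    monoidal
  change _ = (((ρ_ (Z s)).inv ⊗ₘ (ρ_ (Z t)).inv) ≫ (α_ (Z s) (𝟙_ C) (Z t ⊗ 𝟙_ C)).hom ≫
      Z s ◁ (λ_ (Z t ⊗ 𝟙_ C)).hom) ≫ ((α_ (Z s) (Z t) (𝟙_ C)).inv ≫
      (β_ (Z s) (Z t)).hom ▷ 𝟙_ C ≫ (α_ (Z t) (Z s) (𝟙_ C)).hom) ≫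
      (Z t ◁ (λ_ (Z s ⊗ 𝟙_ C)).inv ≫ (α_ (Z t) (𝟙_ C) (Z s ⊗ 𝟙_ C)).inv) ≫
      ((ρ_ (Z t)).hom ⊗ₘ (ρ_ (Z s)).hom)
  rw [key, Category.assoc, Category.assoc, Category.assoc, key']
  simp

theorem braiding_unit_left (p : Pres Z A) :
    IsCanon ((Pres.unit Z).tensor p) (p.tensor (Pres.unit Z)) (β_ (𝟙_ C) A).hom := by
  rw [braiding_tensorUnit_left]
  exact (IsCanon.leftUnitor p).comp (IsCanon.rightUnitor p).inv

theorem braiding_unit_right (p : Pres Z A) :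
    IsCanon (p.tensor (Pres.unit Z)) ((Pres.unit Z).tensor p) (β_ A (𝟙_ C)).hom := by
  rw [braiding_tensorUnit_right]
  exact (IsCanon.rightUnitor p).comp (IsCanon.leftUnitor p).inv

theorem braiding_tensor_left (hp : IsCanon (p.tensor r) (r.tensor p) (β_ A D).hom)
    (hq : IsCanon (q.tensor r) (r.tensor q) (β_ B D).hom) :
    IsCanon ((p.tensor q).tensor r) (r.tensor (p.tensor q)) (β_ (A ⊗ B) D).hom := by
  rw [BraidedCategory.braiding_tensor_left_hom]
  exact (IsCanon.associator p q r).comp <| (IsCanon.whiskerLeft p hq).comp <|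
    (IsCanon.associator p r q).inv.comp <|
    (hp.whiskerRight q).comp (IsCanon.associator r p q)

theorem braiding_tensor_right (hp : IsCanon (r.tensor p) (p.tensor r) (β_ D A).hom)
    (hq : IsCanon (r.tensor q) (q.tensor r) (β_ D B).hom) :
    IsCanon (r.tensor (p.tensor q)) ((p.tensor q).tensor r) (β_ D (A ⊗ B)).hom := by
  rw [BraidedCategory.braiding_tensor_right_hom]
  exact (IsCanon.associator r p q).inv.comp <| (hp.whiskerRight q).comp <|
    (IsCanon.associator p r q).comp <|
    (IsCanon.whiskerLeft p hq).comp (IsCanon.associator p q r).inv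

theorem ofList_leaf (l : List τ) :
    IsCanon (Pres.ofList (Pres.leaf Z) l) ⟨l, Iso.refl _⟩ (𝟙 _) := by
  induction l with
  | nil => exact ⟨Rearr.refl _, by simp [Pres.ofList, Pres.unit, Rearr.hom_refl]⟩
  | cons t l ih =>
    have h : IsCanon ((Pres.leaf Z t).tensor ⟨l, Iso.refl _⟩) ⟨t :: l, Iso.refl _⟩ (𝟙 _) := by
      refine ⟨Rearr.refl _, ?_⟩
      change 𝟙 _ = (((ρ_ (Z t)).inv ⊗ₘ 𝟙 _) ≫ (α_ (Z t) (𝟙_ C) _).hom ≫ Z t ◁ (λ_ _).hom) ≫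
        (Rearr.refl (t :: l)).hom Z ≫ 𝟙 _
      rw [Rearr.hom_refl]
      simp
    have h' := (IsCanon.whiskerLeft (Pres.leaf Z t) ih).comp h
    rwa [MonoidalCategory.whiskerLeft_id, Category.id_comp] at h'

theorem iso_hom (p : Pres Z A) : IsCanon p (Pres.ofList (Pres.leaf Z) p.word) p.iso.hom := by
  have h : IsCanon p ⟨p.word, Iso.refl _⟩ p.iso.hom := ⟨Rearr.refl _, by simp [Rearr.hom_refl]⟩
  have h' := h.comp (IsCanon.inv (f := Iso.refl _) (ofList_leaf p.word))
  rwa [Iso.refl_inv, Category.comp_id] at h'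

theorem braiding_leaf_ofList (s : τ) (l : List τ) :
    IsCanon ((Pres.leaf Z s).tensor (.ofList (Pres.leaf Z) l))
      ((Pres.ofList (Pres.leaf Z) l).tensor (Pres.leaf Z s)) (β_ (Z s) (listTensor Z l)).hom := by
  induction l with
  | nil => exact braiding_unit_right _
  | cons t l ih => exact braiding_tensor_right (braiding_leaf_leaf s t) ih

theorem braiding_ofList_ofList (l m : List τ) :
    IsCanon ((Pres.ofList (Pres.leaf Z) l).tensor (.ofList (Pres.leaf Z) m))
      ((Pres.ofList (Pres.leaf Z) m).tensor (.ofList (Pres.leaf Z) l))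
      (β_ (listTensor Z l) (listTensor Z m)).hom := by
  induction l with
  | nil => exact braiding_unit_left _
  | cons t l ih => exact braiding_tensor_left (braiding_leaf_ofList t m) ih

protected theorem braiding (p : Pres Z A) (q : Pres Z B) :
    IsCanon (p.tensor q) (q.tensor p) (β_ A B).hom := by
  have hconj : (β_ A B).hom =
      (p.iso ⊗ᵢ q.iso).hom ≫ (β_ _ _).hom ≫ (q.iso ⊗ᵢ p.iso).inv := by
    rw [tensorIso_hom, tensorIso_inv, BraidedCategory.braiding_naturality_assoc,
      tensorHom_comp_tensorHom]
    simp
  rw [hconj]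
  exact ((iso_hom p).tensor (iso_hom q)).comp <|
    (braiding_ofList_ofList p.word q.word).comp ((iso_hom q).tensor (iso_hom p)).inv

protected theorem swapFirst (p : Pres Z A) (q : Pres Z B) (r : Pres Z D) :
    IsCanon (p.tensor (q.tensor r)) (q.tensor (p.tensor r)) (swapFirst A B D) :=
  (IsCanon.associator p q r).inv.comp <|
    ((IsCanon.braiding p q).whiskerRight r).comp (IsCanon.associator q p r)

protected theorem tensorμ (p : Pres Z A) (q : Pres Z B) (r : Pres Z D) (r' : Pres Z E) :
    IsCanon ((p.tensor q).tensor (r.tensor r')) ((p.tensor r).tensor (q.tensor r'))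
      (tensorμ A B D E) :=
  (IsCanon.associator p q _).comp <| (IsCanon.whiskerLeft p (IsCanon.associator q r r').inv).comp <|
    (IsCanon.whiskerLeft p ((IsCanon.braiding q r).whiskerRight r')).comp <|
    (IsCanon.whiskerLeft p (IsCanon.associator r q r')).comp (IsCanon.associator p r _).inv

section List

variable {ι κ : Type} {X : κ → C} {Y : ι → C}

theorem rearr_hom (p : ∀ k, Pres Z (X k)) {l l' : List κ} (w : Rearr l l') :
    IsCanon (Pres.ofList p l) (Pres.ofList p l') (w.hom X) := by
  induction w with
  | nil => exact .id _
  | cons a w ih => exact .whiskerLeft _ ih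
  | swap a b l => exact .swapFirst _ _ _
  | trans w w' ih ih' => exact ih.comp ih'

protected theorem permHom (p : ∀ k, Pres Z (X k)) {l l' : List κ} (h : l.Perm l') :
    IsCanon (Pres.ofList p l) (Pres.ofList p l') (permHom X h) :=
  rearr_hom p _

protected theorem listTensorMap {X' : κ → C} {p : ∀ k, Pres Z (X k)} {p' : ∀ k, Pres Z (X' k)}
    {f : ∀ k, X k ⟶ X' k} (hf : ∀ k, IsCanon (p k) (p' k) (f k)) (l : List κ) :
    IsCanon (Pres.ofList p l) (Pres.ofList p' l) (listTensorMap f l) := by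
  induction l with
  | nil => exact .id _
  | cons a l ih => exact (hf a).tensor ih

protected theorem listTensorRelabel (e : ι → κ) (p : ∀ k, Pres Z (X k)) (l : List ι) :
    IsCanon (Pres.ofList (fun i => p (e i)) l) (Pres.ofList p (l.map e))
      (listTensorRelabel e X l).hom := by
  induction l with
  | nil => exact .id _
  | cons a l ih => exact .whiskerLeft _ ih

protected theorem listTensorAppend (p : ∀ k, Pres Z (X k)) (l m : List κ) :
    IsCanon (Pres.ofList p (l ++ m)) ((Pres.ofList p l).tensor (Pres.ofList p m))
      (listTensorAppend X l m).hom := by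
  induction l with
  | nil => exact (IsCanon.leftUnitor _).inv
  | cons a l ih => exact (IsCanon.whiskerLeft _ ih).comp (IsCanon.associator _ _ _).inv

protected theorem listTensorUnits (l : List κ) :
    IsCanon (Pres.ofList (fun _ => Pres.unit Z) l) (Pres.unit Z) (listTensorUnits l) := by
  induction l with
  | nil => exact .id _
  | cons _ l ih => exact (IsCanon.leftUnitor _).comp ih

protected theorem listTensorZip {X' : κ → C} (p : ∀ k, Pres Z (X k)) (p' : ∀ k, Pres Z (X' k))
    (l : List κ) : IsCanon ((Pres.ofList p l).tensor (Pres.ofList p' l))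
      (Pres.ofList (fun k => (p k).tensor (p' k)) l) (listTensorZip X X' l) := by
  induction l with
  | nil => exact .leftUnitor _
  | cons a l ih => exact (IsCanon.tensorμ _ _ _ _).comp (IsCanon.whiskerLeft _ ih)

protected theorem listTensorSigma {β : ι → Type} {Y : (Σ i, β i) → C} (p : ∀ x, Pres Z (Y x))
    (m : ∀ i, List (β i)) (l : List ι) :
    IsCanon (Pres.ofList p (l.sigma m))
      (Pres.ofList (fun i => Pres.ofList (fun b => p ⟨i, b⟩) (m i)) l)
      (listTensorSigma Y m l) := by
  induction l with
  | nil => exact .id _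
  | cons a l ih =>
    exact (IsCanon.listTensorAppend p _ _).comp
      ((IsCanon.listTensorRelabel (Sigma.mk a) p (m a)).inv.tensor ih)

end List

section Over

variable {ι κ : Type} [Fintype ι] [Fintype κ] {X : κ → C} {Y : ι → C}

protected theorem tensorOverMap {p : ∀ i, Pres Z (Y i)} {q : ∀ k, Pres Z (X k)} (e : ι ≃ κ)
    {f : ∀ i, Y i ⟶ X (e i)} (hf : ∀ i, IsCanon (p i) (q (e i)) (f i)) :
    IsCanon (Pres.all p) (Pres.all q) (tensorOverMap e f) :=
  (IsCanon.listTensorMap hf _).comp <|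
    (IsCanon.listTensorRelabel e q _).comp (IsCanon.permHom q _)

protected theorem tensorOverPUnit {X : PUnit.{1} → C} (p : ∀ k, Pres Z (X k)) :
    IsCanon (Pres.all p) (p PUnit.unit) (tensorOverPUnit X) :=
  (IsCanon.permHom p _).comp (IsCanon.rightUnitor _)

protected theorem tensorOverUnits :
    IsCanon (Pres.all fun _ : κ => Pres.unit Z) (Pres.unit Z) (tensorOverUnits κ) :=
  IsCanon.listTensorUnits _

protected theorem tensorOverZip {X' : κ → C} (p : ∀ k, Pres Z (X k)) (p' : ∀ k, Pres Z (X' k)) :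
    IsCanon ((Pres.all p).tensor (Pres.all p')) (Pres.all fun k => (p k).tensor (p' k))
      (tensorOverZip X X') :=
  IsCanon.listTensorZip p p' _

protected theorem tensorOverSigma {β : ι → Type} [∀ i, Fintype (β i)] {Y : (Σ i, β i) → C}
    (p : ∀ x, Pres Z (Y x)) :
    IsCanon (Pres.all p) (Pres.all fun i => Pres.all fun b => p ⟨i, b⟩) (tensorOverSigma Y) :=
  (IsCanon.permHom p _).comp (IsCanon.listTensorSigma p _ _)

end Over

end IsCanon

end IsCanon

section IsInduced

variable {C : Type u} [Category.{v} C] [MonoidalCategory C] {τ τ' : Type} {Z : τ → C} {Z' : τ' → C}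

/-- The morphism between tensor products along a list and its image under a relabelling `e`
induced by morphisms between corresponding factors. -/
def listTensorMapAlong (e : τ → τ') (g : ∀ t, Z t ⟶ Z' (e t)) :
    ∀ l : List τ, listTensor Z l ⟶ listTensor Z' (l.map e)
  | [] => 𝟙 _
  | t :: l => g t ⊗ₘ listTensorMapAlong e g l

theorem listTensorMap_comp_relabel (e : τ → τ') (g : ∀ t, Z t ⟶ Z' (e t)) (l : List τ) :
    listTensorMap g l ≫ (listTensorRelabel e Z' l).hom = listTensorMapAlong e g l := by
  induction l with
  | nil => exact Category.comp_id _
  | cons t l ih =>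
    change (g t ⊗ₘ listTensorMap g l) ≫ Z' (e t) ◁ (listTensorRelabel e Z' l).hom =
      g t ⊗ₘ listTensorMapAlong e g l
    rw [← id_tensorHom, tensorHom_comp_tensorHom, ih, Category.comp_id]

variable [SymmetricCategory C]

theorem Rearr.hom_comp_listTensorMapAlong (e : τ → τ') (g : ∀ t, Z t ⟶ Z' (e t)) {l l' : List τ}
    (w : Rearr l l') :
    w.hom Z ≫ listTensorMapAlong e g l' = listTensorMapAlong e g l ≫ (w.map e).hom Z' := by
  rw [← listTensorMap_comp_relabel, ← listTensorMap_comp_relabel, ← Category.assoc, w.hom_natural g,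
    Category.assoc, w.hom_relabel e Z', Category.assoc]

theorem exists_rearr_listTensorMapAlong_append (e : τ → τ') (g : ∀ t, Z t ⟶ Z' (e t))
    (l m : List τ) :
    ∃ w : Rearr ((l ++ m).map e) (l.map e ++ m.map e),
      listTensorMapAlong e g (l ++ m) ≫ w.hom Z' ≫ (listTensorAppend Z' _ _).hom =
        (listTensorAppend Z l m).hom ≫ (listTensorMapAlong e g l ⊗ₘ listTensorMapAlong e g m) := by
  induction l with
  | nil =>
    refine ⟨Rearr.refl _, ?_⟩
    change listTensorMapAlong e g m ≫ (Rearr.refl (m.map e)).hom Z' ≫ (λ_ _).inv =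
      (λ_ _).inv ≫ (𝟙 _ ⊗ₘ listTensorMapAlong e g m)
    rw [Rearr.hom_refl, Category.id_comp, leftUnitor_inv_naturality, id_tensorHom]
  | cons t l ih =>
    obtain ⟨w, h⟩ := ih
    refine ⟨.cons (e t) w, ?_⟩
    change (g t ⊗ₘ listTensorMapAlong e g (l ++ m)) ≫ Z' (e t) ◁ w.hom Z' ≫
        Z' (e t) ◁ (listTensorAppend Z' _ _).hom ≫ (α_ _ _ _).inv =
      (Z t ◁ (listTensorAppend Z l m).hom ≫ (α_ _ _ _).inv) ≫
        ((g t ⊗ₘ listTensorMapAlong e g l) ⊗ₘ listTensorMapAlong e g m)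
    rw [Category.assoc, ← associator_inv_naturality, ← id_tensorHom, ← id_tensorHom,
      ← id_tensorHom, tensorHom_comp_tensorHom_assoc, tensorHom_comp_tensorHom_assoc,
      tensorHom_comp_tensorHom_assoc]
    simp only [Category.comp_id, Category.id_comp, Category.assoc, h]

/-- A morphism between presented objects is induced by morphisms `g t : Z t ⟶ Z' (e t)` between
the letters if it is obtained by applying `g` letter by letter and then rearranging. Two natural
transformations built from canonical morphisms are compared through this notion. -/
def IsInduced {A B : C} (e : τ → τ') (g : ∀ t, Z t ⟶ Z' (e t)) (p : Pres Z A) (q : Pres Z' B)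
    (f : A ⟶ B) : Prop :=
  ∃ w : Rearr (p.word.map e) q.word,
    f = p.iso.hom ≫ listTensorMapAlong e g p.word ≫ w.hom Z' ≫ q.iso.inv

namespace IsInduced

variable {A B A' B' : C} {e : τ → τ'} {g : ∀ t, Z t ⟶ Z' (e t)}

theorem unique {p : Pres Z A} {q : Pres Z' B} (he : Function.Injective e) (hp : p.word.Nodup)
    {f f' : A ⟶ B} (hf : IsInduced e g p q f) (hf' : IsInduced e g p q f') : f = f' := by
  obtain ⟨w, rfl⟩ := hf
  obtain ⟨w', rfl⟩ := hf'
  rw [Rearr.coherence Z' (hp.map he) w w']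

theorem comp_isCanon {p : Pres Z A} {q : Pres Z' B} {q' : Pres Z' B'} {f : A ⟶ B} {c : B ⟶ B'}
    (hf : IsInduced e g p q f) (hc : IsCanon q q' c) : IsInduced e g p q' (f ≫ c) := by
  obtain ⟨w, rfl⟩ := hf
  obtain ⟨w', rfl⟩ := hc
  exact ⟨w.trans w', by simp [Rearr.hom]⟩

theorem isCanon_comp {p : Pres Z A} {p' : Pres Z A'} {q : Pres Z' B} {c : A ⟶ A'} {f : A' ⟶ B}
    (hc : IsCanon p p' c) (hf : IsInduced e g p' q f) : IsInduced e g p q (c ≫ f) := by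
  obtain ⟨w, rfl⟩ := hc
  obtain ⟨w', rfl⟩ := hf
  refine ⟨(w.map e).trans w', ?_⟩
  have h := w.hom_comp_listTensorMapAlong e g
  simp [Rearr.hom, reassoc_of% h]

theorem leaf (t : τ) : IsInduced e g (Pres.leaf Z t) (Pres.leaf Z' (e t)) (g t) := by
  refine ⟨Rearr.refl _, ?_⟩
  change g t = (ρ_ (Z t)).inv ≫ (g t ⊗ₘ 𝟙 _) ≫ (Rearr.refl [e t]).hom Z' ≫ (ρ_ (Z' (e t))).hom
  rw [Rearr.hom_refl]
  simp

protected theorem tensor {p : Pres Z A} {q : Pres Z' B} {p' : Pres Z A'} {q' : Pres Z' B'}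
    {f : A ⟶ B} {f' : A' ⟶ B'} (hf : IsInduced e g p q f) (hf' : IsInduced e g p' q' f') :
    IsInduced e g (p.tensor p') (q.tensor q') (f ⊗ₘ f') := by
  obtain ⟨w, rfl⟩ := hf
  obtain ⟨w', rfl⟩ := hf'
  obtain ⟨v, hv⟩ := exists_rearr_listTensorMapAlong_append e g p.word p'.word
  obtain ⟨u, hu⟩ : ∃ u : Rearr (p.word.map e ++ p'.word.map e) (q.tensor q').word,
      (w.hom Z' ≫ q.iso.inv) ⊗ₘ (w'.hom Z' ≫ q'.iso.inv) =
        (listTensorAppend Z' _ _).inv ≫ u.hom Z' ≫ (q.tensor q').iso.inv := by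
    obtain ⟨u, hu⟩ := IsCanon.tensor (p := ⟨p.word.map e, Iso.refl _⟩) (q := q)
      (r := ⟨p'.word.map e, Iso.refl _⟩) (r' := q') ⟨w, (Category.id_comp _).symm⟩
      ⟨w', (Category.id_comp _).symm⟩
    refine ⟨u, hu.trans ?_⟩
    simp [Pres.tensor]
  rw [← Category.assoc, ← Iso.eq_comp_inv, Category.assoc] at hv
  refine ⟨v.trans u, ?_⟩
  change _ = ((p.iso.hom ⊗ₘ p'.iso.hom) ≫ (listTensorAppend Z _ _).inv) ≫
    listTensorMapAlong e g (p.word ++ p'.word) ≫ (v.hom Z' ≫ u.hom Z') ≫ (q.tensor q').iso.inv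
  rw [Category.assoc, Category.assoc, reassoc_of% hv, Iso.inv_hom_id_assoc, ← hu]
  simp only [tensorHom_comp_tensorHom]

protected theorem listTensorMap {κ : Type} {X Y : κ → C} {p : ∀ k, Pres Z (X k)}
    {q : ∀ k, Pres Z' (Y k)} {f : ∀ k, X k ⟶ Y k} (hf : ∀ k, IsInduced e g (p k) (q k) (f k))
    (l : List κ) : IsInduced e g (Pres.ofList p l) (Pres.ofList q l) (listTensorMap f l) := by
  induction l with
  | nil =>
    refine ⟨.nil, ?_⟩
    change 𝟙 _ = 𝟙 _ ≫ 𝟙 _ ≫ 𝟙 _ ≫ 𝟙 _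
    simp only [Category.comp_id]
  | cons k l ih => exact (hf k).tensor ih

protected theorem tensorOverMap {ι κ : Type} [Fintype ι] [Fintype κ] {X : ι → C} {Y : κ → C}
    {p : ∀ i, Pres Z (X i)} {q : ∀ k, Pres Z' (Y k)} (e₀ : ι ≃ κ) {f : ∀ i, X i ⟶ Y (e₀ i)}
    (hf : ∀ i, IsInduced e g (p i) (q (e₀ i)) (f i)) :
    IsInduced e g (Pres.all p) (Pres.all q) (tensorOverMap e₀ f) :=
  (IsInduced.listTensorMap hf _).comp_isCanon <|
    (IsCanon.listTensorRelabel e₀ q _).comp (IsCanon.permHom q _)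

end IsInduced

end IsInduced

section Distrib

variable {C : Type u} [Category.{v} C] [MonoidalCategory C] [SymmetricCategory C]

/-- The morphism between unordered tensor products of families over the same index set induced by
morphisms between the factors. -/
def tensorOverPi {κ : Type} [Fintype κ] {X Y : κ → C} (f : ∀ k, X k ⟶ Y k) :
    tensorOver X ⟶ tensorOver Y :=
  tensorOverMap (Equiv.refl κ) f

theorem tensorOverPi_id {κ : Type} [Fintype κ] (X : κ → C) :
    tensorOverPi (fun k => 𝟙 (X k)) = 𝟙 (tensorOver X) :=
  tensorOverMap_id X

theorem tensorOverPi_comp {κ : Type} [Fintype κ] {X Y Z : κ → C} (f : ∀ k, X k ⟶ Y k)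
    (g : ∀ k, Y k ⟶ Z k) :
    tensorOverPi (fun k => f k ≫ g k) = tensorOverPi f ≫ tensorOverPi g :=
  tensorOverMap_comp (Equiv.refl κ) (Equiv.refl κ) f g

/-- The canonical morphism `(⨂ cᵢ) ⊗ (⨂ Y (i, b)) ⟶ ⨂ᵢ (cᵢ ⊗ ⨂_b Y (i, b))`. -/
def tensorOverDistrib {ι : Type} [Fintype ι] {β : ι → Type} [∀ i, Fintype (β i)] (c : ι → C)
    (Y : (Σ i, β i) → C) :
    tensorOver c ⊗ tensorOver Y ⟶ tensorOver fun i => c i ⊗ tensorOver fun b => Y ⟨i, b⟩ :=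
  _ ◁ tensorOverSigma Y ≫ tensorOverZip _ _

protected theorem IsCanon.tensorOverDistrib {τ : Type} {Z : τ → C} {ι : Type} [Fintype ι]
    {β : ι → Type} [∀ i, Fintype (β i)] {c : ι → C} {Y : (Σ i, β i) → C}
    (p : ∀ i, Pres Z (c i)) (q : ∀ x, Pres Z (Y x)) :
    IsCanon ((Pres.all p).tensor (Pres.all q))
      (Pres.all fun i => (p i).tensor (Pres.all fun b => q ⟨i, b⟩)) (tensorOverDistrib c Y) :=
  (IsCanon.whiskerLeft _ (IsCanon.tensorOverSigma q)).comp (IsCanon.tensorOverZip _ _)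

theorem tensorOverDistrib_natural {ι κ : Type} [Fintype ι] [Fintype κ] {β : ι → Type}
    {δ : κ → Type} [∀ i, Fintype (β i)] [∀ k, Fintype (δ k)] {c : ι → C} {c' : κ → C}
    {Y : (Σ i, β i) → C} {Y' : (Σ k, δ k) → C} (e : ι ≃ κ) (e' : ∀ i, β i ≃ δ (e i))
    (g : ∀ i, c i ⟶ c' (e i)) (f : ∀ x : Σ i, β i, Y x ⟶ Y' ⟨e x.1, e' x.1 x.2⟩) :
    (tensorOverMap e g ⊗ₘ tensorOverMap (Equiv.sigmaCongr e e') f) ≫ tensorOverDistrib c' Y' =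
      tensorOverDistrib c Y ≫
        tensorOverMap (Y := fun k => c' k ⊗ tensorOver fun d : δ k => Y' ⟨k, d⟩) e fun i =>
          g i ⊗ₘ tensorOverMap (Y := fun d => Y' ⟨e i, d⟩) (e' i) fun b => f ⟨i, b⟩ := by
  let Z : ι ⊕ (Σ i, β i) → C := Sum.elim c Y
  let Z' : κ ⊕ (Σ k, δ k) → C := Sum.elim c' Y'
  let E : ι ⊕ (Σ i, β i) → κ ⊕ (Σ k, δ k) := Sum.map e (Equiv.sigmaCongr e e')
  let G : ∀ t, Z t ⟶ Z' (E t) := Sum.rec g f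
  let p : ∀ i, Pres Z (c i) := fun i => Pres.leaf Z (.inl i)
  let q : ∀ x, Pres Z (Y x) := fun x => Pres.leaf Z (.inr x)
  let p' : ∀ k, Pres Z' (c' k) := fun k => Pres.leaf Z' (.inl k)
  let q' : ∀ x, Pres Z' (Y' x) := fun x => Pres.leaf Z' (.inr x)
  have hg (i : ι) : IsInduced E G (p i) (p' (e i)) (g i) := IsInduced.leaf (g := G) (.inl i)
  have hf (x : Σ i, β i) : IsInduced E G (q x) (q' ⟨e x.1, e' x.1 x.2⟩) (f x) :=
    IsInduced.leaf (g := G) (.inr x)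
  refine IsInduced.unique (e := E) (g := G) (p := (Pres.all p).tensor (Pres.all q))
    (q := Pres.all fun k => (p' k).tensor (Pres.all fun d => q' ⟨k, d⟩))
    (e.injective.sumMap (Equiv.sigmaCongr e e').injective) ?_ ?_ ?_
  · exact Pres.nodup_word_tensor_all_leaf (Pres.nodup_word_all_leaf Sum.inl_injective)
      Sum.inr_injective fun _ => Pres.not_mem_word_all_leaf fun _ => Sum.inl_ne_inr
  · exact .comp_isCanon
      ((IsInduced.tensorOverMap e hg).tensor (IsInduced.tensorOverMap (q := q') _ hf))
      (IsCanon.tensorOverDistrib p' q')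
  · exact .isCanon_comp (IsCanon.tensorOverDistrib p q) <| IsInduced.tensorOverMap
      (q := fun k => (p' k).tensor (Pres.all fun d => q' ⟨k, d⟩)) e fun i =>
        (hg i).tensor <| IsInduced.tensorOverMap (q := fun d => q' ⟨e i, d⟩) (e' i) fun b =>
          hf ⟨i, b⟩

theorem tensorOverDistrib_natural_pi {ι : Type} [Fintype ι] {β : ι → Type}
    [∀ i, Fintype (β i)] {c c' : ι → C} {Y Y' : (Σ i, β i) → C} (g : ∀ i, c i ⟶ c' i)
    (f : ∀ x, Y x ⟶ Y' x) :
    (tensorOverPi g ⊗ₘ tensorOverPi f) ≫ tensorOverDistrib c' Y' =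
      tensorOverDistrib c Y ≫ tensorOverPi fun i => g i ⊗ₘ tensorOverPi fun b => f ⟨i, b⟩ := by
  exact tensorOverDistrib_natural (Equiv.refl ι) (fun i => Equiv.refl (β i)) g f

theorem tensorOverDistrib_natural_left {ι : Type} [Fintype ι] {β : ι → Type}
    [∀ i, Fintype (β i)] {c c' : ι → C} (Y : (Σ i, β i) → C) (g : ∀ i, c i ⟶ c' i) :
    tensorOverPi g ▷ tensorOver Y ≫ tensorOverDistrib c' Y =
      tensorOverDistrib c Y ≫ tensorOverPi fun i => g i ▷ tensorOver fun b => Y ⟨i, b⟩ := by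
  simpa only [tensorOverPi_id, tensorHom_id] using
    tensorOverDistrib_natural_pi g fun x => 𝟙 (Y x)

theorem tensorOverDistrib_natural_right {ι : Type} [Fintype ι] {β : ι → Type}
    [∀ i, Fintype (β i)] (c : ι → C) {Y Y' : (Σ i, β i) → C} (f : ∀ x, Y x ⟶ Y' x) :
    tensorOver c ◁ tensorOverPi f ≫ tensorOverDistrib c Y' =
      tensorOverDistrib c Y ≫ tensorOverPi fun i => c i ◁ tensorOverPi fun b => f ⟨i, b⟩ := by
  simpa only [tensorOverPi_id, id_tensorHom] using
    tensorOverDistrib_natural_pi (fun i => 𝟙 (c i)) f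

theorem tensorOverDistrib_assoc {ι : Type} [Fintype ι] {β : ι → Type} [∀ i, Fintype (β i)]
    {δ : ∀ i, β i → Type} [∀ i b, Fintype (δ i b)] (c : ι → C) (c' : (Σ i, β i) → C)
    (Y : (Σ x : Σ i, β i, δ x.1 x.2) → C) :
    _ ◁ tensorOverMap (X := fun x : Σ i, Σ b : β i, δ i b => Y ⟨⟨x.1, x.2.1⟩, x.2.2⟩)
          (Equiv.sigmaAssoc δ).symm (fun x => 𝟙 (Y ⟨⟨x.1, x.2.1⟩, x.2.2⟩)) ≫
        (α_ _ _ _).hom ≫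
        tensorOver c ◁ tensorOverDistrib (β := fun x : Σ i, β i => δ x.1 x.2) c' Y ≫
        tensorOverDistrib c (fun x : Σ i, β i => c' x ⊗ tensorOver fun d => Y ⟨x, d⟩) =
      tensorOverDistrib c c' ▷ _ ≫
        tensorOverDistrib (fun i => c i ⊗ tensorOver fun b => c' ⟨i, b⟩)
          (fun x : Σ i, Σ b : β i, δ i b => Y ⟨⟨x.1, x.2.1⟩, x.2.2⟩) ≫
        tensorOverPi fun i => (α_ _ _ _).hom ≫
          c i ◁ tensorOverDistrib (fun b => c' ⟨i, b⟩) fun x : Σ b : β i, δ i b =>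
            Y ⟨⟨i, x.1⟩, x.2⟩ := by
  let Z : ι ⊕ (Σ i, β i) ⊕ (Σ x : Σ i, β i, δ x.1 x.2) → C := Sum.elim c (Sum.elim c' Y)
  let p : ∀ i, Pres Z (c i) := fun i => Pres.leaf Z (.inl i)
  let p' : ∀ x, Pres Z (c' x) := fun x => Pres.leaf Z (.inr (.inl x))
  let q : ∀ x, Pres Z (Y x) := fun x => Pres.leaf Z (.inr (.inr x))
  let q' : ∀ x : Σ i, Σ b : β i, δ i b, Pres Z (Y ⟨⟨x.1, x.2.1⟩, x.2.2⟩) :=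
    fun x => q ⟨⟨x.1, x.2.1⟩, x.2.2⟩
  refine IsCanon.unique (p := ((Pres.all p).tensor (Pres.all p')).tensor (Pres.all q'))
    (q := Pres.all fun i => (p i).tensor (Pres.all fun b =>
      (p' ⟨i, b⟩).tensor (Pres.all fun d => q ⟨⟨i, b⟩, d⟩))) ?_ ?_ ?_
  · refine Pres.nodup_word_tensor_all_leaf (Pres.nodup_word_tensor_all_leaf
      (Pres.nodup_word_all_leaf Sum.inl_injective) (Sum.inr_injective.comp Sum.inl_injective) ?_)
      (Sum.inr_injective.comp (Sum.inr_injective.comp (Equiv.sigmaAssoc δ).symm.injective)) ?_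
    · exact fun _ => Pres.not_mem_word_all_leaf fun _ => Sum.inl_ne_inr
    · exact fun _ h => (List.mem_append.1 h).elim
        (Pres.not_mem_word_all_leaf fun _ => Sum.inl_ne_inr)
        (Pres.not_mem_word_all_leaf fun _ => Sum.inr_injective.ne Sum.inl_ne_inr)
  · exact (IsCanon.whiskerLeft _ (IsCanon.tensorOverMap (q := q) (Equiv.sigmaAssoc δ).symm
      fun x => IsCanon.id (q' x))).comp <|
      (IsCanon.associator _ _ _).comp <| (IsCanon.whiskerLeft _
      (IsCanon.tensorOverDistrib (β := fun x : Σ i, β i => δ x.1 x.2) p' q)).comp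
      (IsCanon.tensorOverDistrib p fun x => (p' x).tensor (Pres.all fun d => q ⟨x, d⟩))
  · exact ((IsCanon.tensorOverDistrib p p').whiskerRight _).comp <|
      (IsCanon.tensorOverDistrib (fun i => (p i).tensor (Pres.all fun b => p' ⟨i, b⟩)) q').comp <|
      IsCanon.tensorOverMap (Equiv.refl ι) fun i => (IsCanon.associator _ _ _).comp <|
        IsCanon.whiskerLeft _ (IsCanon.tensorOverDistrib (fun b => p' ⟨i, b⟩)
          fun x : Σ b : β i, δ i b => q ⟨⟨i, x.1⟩, x.2⟩)

theorem tensorOverDistrib_point {β : Type} [Fintype β] (c : PUnit.{1} → C)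
    (Y : (Σ _ : PUnit.{1}, β) → C) :
    tensorOver c ◁ tensorOverMap (X := fun b => Y ⟨PUnit.unit, b⟩)
        (Equiv.uniqueSigma fun _ : PUnit.{1} => β).symm (fun b => 𝟙 (Y ⟨PUnit.unit, b⟩)) ≫
      tensorOverDistrib c Y ≫ tensorOverPUnit (fun i => c i ⊗ tensorOver fun b => Y ⟨i, b⟩) =
      tensorOverPUnit c ▷ _ := by
  let Z : PUnit.{1} ⊕ β → C := Sum.elim c fun b => Y ⟨PUnit.unit, b⟩
  let p : ∀ i, Pres Z (c i) := fun i => Pres.leaf Z (.inl i)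
  let q : ∀ x, Pres Z (Y x) := fun x => Pres.leaf Z (.inr x.2)
  refine IsCanon.unique (p := (Pres.all p).tensor (Pres.all fun b => q ⟨PUnit.unit, b⟩))
    (q := (p PUnit.unit).tensor (Pres.all fun b => q ⟨PUnit.unit, b⟩)) ?_ ?_ ?_
  · exact Pres.nodup_word_tensor_all_leaf (Pres.nodup_word_all_leaf Sum.inl_injective)
      Sum.inr_injective fun _ => Pres.not_mem_word_all_leaf fun _ => Sum.inl_ne_inr
  · exact (IsCanon.whiskerLeft _ (IsCanon.tensorOverMap (q := q)
      (Equiv.uniqueSigma fun _ : PUnit.{1} => β).symm fun b => IsCanon.id _)).comp <|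
      (IsCanon.tensorOverDistrib p q).comp (IsCanon.tensorOverPUnit _)
  · exact (IsCanon.tensorOverPUnit p).whiskerRight _

theorem tensorOverDistrib_points {κ : Type} [Fintype κ] (X : κ → C) :
    tensorOver (fun _ : κ => 𝟙_ C) ◁ tensorOverMap (Y := fun x : Σ _ : κ, PUnit.{1} => X x.1)
        (Equiv.sigmaPUnit κ).symm (fun k => 𝟙 (X k)) ≫
      tensorOverDistrib (fun _ : κ => 𝟙_ C) (fun x : Σ _ : κ, PUnit.{1} => X x.1) ≫
        (tensorOverPi fun k => 𝟙_ C ◁ tensorOverPUnit (fun _ => X k) ≫ (λ_ (X k)).hom) =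
      tensorOverUnits κ ▷ _ ≫ (λ_ _).hom := by
  let q : ∀ x : Σ _ : κ, PUnit.{1}, Pres X (X x.1) := fun x => Pres.leaf X x.1
  refine IsCanon.unique (p := (Pres.all fun _ => Pres.unit X).tensor (Pres.all (Pres.leaf X)))
    (q := Pres.all (Pres.leaf X)) ?_ ?_ ?_
  · exact Pres.nodup_word_tensor_all_leaf (by simp [Pres.word_all_unit]) Function.injective_id
      (by simp [Pres.word_all_unit])
  · exact (IsCanon.whiskerLeft _ (IsCanon.tensorOverMap (q := q) (Equiv.sigmaPUnit κ).symm
      fun b => IsCanon.id _)).comp <|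
      (IsCanon.tensorOverDistrib _ q).comp <| IsCanon.tensorOverMap (Equiv.refl κ) fun k =>
        (IsCanon.whiskerLeft _ (IsCanon.tensorOverPUnit _)).comp (IsCanon.leftUnitor _)
  · exact (IsCanon.tensorOverUnits.whiskerRight _).comp (IsCanon.leftUnitor _)

theorem tensorOverPUnit_natural {X Y : PUnit.{1} → C} (f : ∀ k, X k ⟶ Y k) :
    tensorOverPi f ≫ tensorOverPUnit Y = tensorOverPUnit X ≫ f PUnit.unit :=
  IsInduced.unique (e := id) (g := f) (p := Pres.all (Pres.leaf X))
    (q := Pres.leaf Y PUnit.unit) Function.injective_id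
    (Pres.nodup_word_all_leaf Function.injective_id)
    ((IsInduced.tensorOverMap (q := Pres.leaf Y) (Equiv.refl _) fun k => .leaf k).comp_isCanon
      (IsCanon.tensorOverPUnit (Pres.leaf Y)))
    (.isCanon_comp (IsCanon.tensorOverPUnit (Pres.leaf X)) (.leaf _))

end Distrib

/-! ### Decompositions and counits of the outermost factor -/

section Paste

variable {C : Type u} [Category.{v} C] [MonoidalCategory C]

theorem expansion_square_paste {P₀ P₁ P₂ a Tc Tc' TY TY' Te Q E F G G' : C}
    {m : P₀ ⟶ P₁} {R : TY' ⟶ TY}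
    {d₁ : P₁ ⟶ P₂ ⊗ Tc'} {d₂ : P₂ ⟶ a ⊗ Tc} {d₃ : P₀ ⟶ a ⊗ Te} {p₄ : Te ⟶ F}
    {D₁ : Tc' ⊗ TY ⟶ Q} {D₂ : Tc ⊗ Q ⟶ E} {D₁₂ : Tc ⊗ Tc' ⟶ F} {D₃ : F ⊗ TY' ⟶ G} {l : G ⟶ E}
    {De : Te ⊗ TY' ⟶ G'} {n₄ : G' ⟶ G}
    (h : m ≫ d₁ ≫ d₂ ▷ Tc' ≫ (α_ _ _ _).hom ≫ a ◁ D₁₂ = d₃ ≫ a ◁ p₄)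
    (ha : (Tc ⊗ Tc') ◁ R ≫ (α_ _ _ _).hom ≫ Tc ◁ D₁ ≫ D₂ = D₁₂ ▷ TY' ≫ D₃ ≫ l)
    (hn : p₄ ▷ TY' ≫ D₃ = De ≫ n₄) :
    (m ⊗ₘ R) ≫ (d₁ ▷ TY ≫ (α_ _ _ _).hom ≫ P₂ ◁ D₁) ≫ (d₂ ▷ Q ≫ (α_ _ _ _).hom ≫ a ◁ D₂) =
      (d₃ ▷ TY' ≫ (α_ _ _ _).hom ≫ a ◁ De) ≫ a ◁ (n₄ ≫ l) := by
  calc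
    _ = (m ≫ d₁ ≫ d₂ ▷ Tc' ≫ (α_ _ _ _).hom) ▷ TY' ≫ (α_ _ _ _).hom ≫
        a ◁ ((Tc ⊗ Tc') ◁ R ≫ (α_ _ _ _).hom ≫ Tc ◁ D₁ ≫ D₂) := by
      rw [MonoidalCategory.tensorHom_def]
      simp only [Category.assoc]
      rw [whisker_exchange_assoc, whisker_exchange_assoc, ← associator_naturality_left_assoc,
        whisker_exchange_assoc]
      simp
    _ = (m ≫ d₁ ≫ d₂ ▷ Tc' ≫ (α_ _ _ _).hom ≫ a ◁ D₁₂) ▷ TY' ≫ (α_ _ _ _).hom ≫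
        a ◁ (D₃ ≫ l) := by
      rw [ha]; simp
    _ = d₃ ▷ TY' ≫ (α_ _ _ _).hom ≫ a ◁ (p₄ ▷ TY' ≫ D₃) ≫ a ◁ l := by
      rw [h]; simp
    _ = _ := by rw [hn]; simp

end Paste

section Expand

variable {C : Type u} [Category.{v} C] [MonoidalCategory C] [SymmetricCategory C]
  {ι : Type} [Fintype ι] {β : ι → Type} [∀ i, Fintype (β i)]

/-- Expanding the first factor of `P ⊗ ⨂ Y (i, b)` by `d : P ⟶ a ⊗ ⨂ cᵢ`, and distributing
the factors `Y (i, b)` over the factors `cᵢ`. For `P = A (⨿ Sᵢ)` and `d` a decomposition of `A`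
this is a decomposition applied to the outermost factor of an iterated product. -/
def expand {P a : C} {c : ι → C} (d : P ⟶ a ⊗ tensorOver c) (Y : (Σ i, β i) → C) :
    P ⊗ tensorOver Y ⟶ a ⊗ tensorOver fun i => c i ⊗ tensorOver fun b => Y ⟨i, b⟩ :=
  d ▷ _ ≫ (α_ _ _ _).hom ≫ a ◁ tensorOverDistrib c Y

theorem expand_natural {κ : Type} [Fintype κ] {δ : κ → Type} [∀ k, Fintype (δ k)] {P P' a a' : C}
    {c : ι → C} {c' : κ → C} {d : P ⟶ a ⊗ tensorOver c} {d' : P' ⟶ a' ⊗ tensorOver c'}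
    {Y : (Σ i, β i) → C} {Y' : (Σ k, δ k) → C} {m : P ⟶ P'} {k : a ⟶ a'} (e : ι ≃ κ)
    (e' : ∀ i, β i ≃ δ (e i)) {g : ∀ i, c i ⟶ c' (e i)}
    (f : ∀ x : Σ i, β i, Y x ⟶ Y' ⟨e x.1, e' x.1 x.2⟩)
    (h : m ≫ d' = d ≫ (k ⊗ₘ tensorOverMap e g)) :
    (m ⊗ₘ tensorOverMap (Equiv.sigmaCongr e e') f) ≫ expand d' Y' =
      expand d Y ≫
        (k ⊗ₘ tensorOverMap (Y := fun k => c' k ⊗ tensorOver fun d : δ k => Y' ⟨k, d⟩) e fun i =>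
          g i ⊗ₘ tensorOverMap (Y := fun d => Y' ⟨e i, d⟩) (e' i) fun b => f ⟨i, b⟩) := by
  have hn := tensorOverDistrib_natural e e' g f
  simp only [expand, Category.assoc]
  rw [← id_tensorHom a, tensorHom_comp_tensorHom, Category.id_comp, ← hn,
    ← tensorHom_id, ← tensorHom_id, tensorHom_comp_tensorHom_assoc, h, Category.comp_id,
    ← Category.comp_id k, ← tensorHom_comp_tensorHom, ← associator_naturality_assoc,
    tensorHom_comp_tensorHom_assoc, Category.id_comp, id_tensorHom]
  simp

theorem expand_natural_pi {P a : C} {c : ι → C} (d : P ⟶ a ⊗ tensorOver c)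
    {Y Y' : (Σ i, β i) → C} (f : ∀ x, Y x ⟶ Y' x) :
    P ◁ tensorOverPi f ≫ expand d Y' =
      expand d Y ≫ a ◁ tensorOverPi fun i => c i ◁ tensorOverPi fun b => f ⟨i, b⟩ := by
  have hn := tensorOverDistrib_natural_right c f
  simp only [expand, Category.assoc]
  rw [← MonoidalCategory.whiskerLeft_comp, ← hn, whisker_exchange_assoc]
  simp

theorem expand_expand {δ : ∀ i, β i → Type} [∀ i b, Fintype (δ i b)] {P₀ P₁ P₂ a : C}
    {c e : ι → C} {c' : (Σ i, β i) → C} {m : P₀ ⟶ P₁} {d₁ : P₁ ⟶ P₂ ⊗ tensorOver c'}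
    {d₂ : P₂ ⟶ a ⊗ tensorOver c} {d₃ : P₀ ⟶ a ⊗ tensorOver e}
    {d₄ : ∀ i, e i ⟶ c i ⊗ tensorOver fun b => c' ⟨i, b⟩}
    (h : m ≫ d₁ ≫ expand d₂ c' = d₃ ≫ a ◁ tensorOverPi d₄)
    (Y : (Σ x : Σ i, β i, δ x.1 x.2) → C) :
    (m ⊗ₘ tensorOverMap (X := fun x : Σ i, Σ b : β i, δ i b => Y ⟨⟨x.1, x.2.1⟩, x.2.2⟩)
          (Equiv.sigmaAssoc δ).symm (fun x => 𝟙 (Y ⟨⟨x.1, x.2.1⟩, x.2.2⟩))) ≫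
        expand (β := fun x : Σ i, β i => δ x.1 x.2) d₁ Y ≫
        expand d₂ (fun x : Σ i, β i => c' x ⊗ tensorOver fun d => Y ⟨x, d⟩) =
      expand d₃ (fun x : Σ i, Σ b : β i, δ i b => Y ⟨⟨x.1, x.2.1⟩, x.2.2⟩) ≫
        a ◁ tensorOverPi fun i =>
          expand (d₄ i) fun x : Σ b : β i, δ i b => Y ⟨⟨i, x.1⟩, x.2⟩ := by
  have ha := tensorOverDistrib_assoc (δ := δ) c c' Y
  have hn := tensorOverDistrib_natural_left (β := fun i => Σ b : β i, δ i b)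
    (fun x : Σ i, Σ b : β i, δ i b => Y ⟨⟨x.1, x.2.1⟩, x.2.2⟩) d₄
  exact (expansion_square_paste h ha hn).trans
    (congrArg (_ ≫ a ◁ ·) (tensorOverPi_comp _ _).symm)

theorem expand_point {β : Type} [Fintype β] {P a : C} {c : PUnit.{1} → C}
    {m : c PUnit.unit ⟶ P} {d : P ⟶ a ⊗ tensorOver c} {ε : a ⟶ 𝟙_ C}
    (h : m ≫ d ≫ (ε ⊗ₘ tensorOverPUnit c) ≫ (λ_ _).hom = 𝟙 _) (Y : (Σ _ : PUnit.{1}, β) → C) :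
    (m ⊗ₘ tensorOverMap (X := fun b => Y ⟨PUnit.unit, b⟩)
        (Equiv.uniqueSigma fun _ : PUnit.{1} => β).symm (fun b => 𝟙 (Y ⟨PUnit.unit, b⟩))) ≫
      expand d Y ≫ (ε ⊗ₘ tensorOverPUnit fun i => c i ⊗ tensorOver fun b => Y ⟨i, b⟩) ≫
        (λ_ _).hom = 𝟙 _ := by
  have hp := tensorOverDistrib_point c Y
  set R := tensorOverMap (X := fun b => Y ⟨PUnit.unit, b⟩)
    (Equiv.uniqueSigma fun _ : PUnit.{1} => β).symm (fun b => 𝟙 (Y ⟨PUnit.unit, b⟩))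
  set q := tensorOverPUnit fun i => c i ⊗ tensorOver fun b => Y ⟨i, b⟩
  calc
    _ = (m ≫ d) ▷ _ ≫ (α_ _ _ _).hom ≫
        (ε ⊗ₘ (tensorOver c ◁ R ≫ tensorOverDistrib c Y ≫ q)) ≫ (λ_ _).hom := by
      rw [MonoidalCategory.tensorHom_def m, MonoidalCategory.tensorHom_def' ε,
        MonoidalCategory.tensorHom_def' ε]
      simp only [expand, Category.assoc]
      rw [whisker_exchange_assoc]
      simp
    _ = (m ≫ d ≫ (ε ⊗ₘ tensorOverPUnit c) ≫ (λ_ _).hom) ▷ _ := by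
      rw [hp, MonoidalCategory.tensorHom_def, MonoidalCategory.tensorHom_def]
      simp
    _ = _ := by rw [h]; simp

theorem expand_points {P P' a : C} {m : P ⟶ P'} {d : P' ⟶ P ⊗ tensorOver fun _ : ι => a}
    {ε : a ⟶ 𝟙_ C}
    (h : m ≫ d ≫ P ◁ (tensorOverPi fun _ => ε) ≫ P ◁ tensorOverUnits ι ≫ (ρ_ P).hom = 𝟙 P)
    (X : ι → C) :
    (m ⊗ₘ tensorOverMap (Y := fun x : Σ _ : ι, PUnit.{1} => X x.1)
        (Equiv.sigmaPUnit ι).symm (fun k => 𝟙 (X k))) ≫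
      expand d (fun x : Σ _ : ι, PUnit.{1} => X x.1) ≫
        (P ◁ tensorOverPi fun k => (ε ⊗ₘ tensorOverPUnit fun _ => X k) ≫ (λ_ _).hom) = 𝟙 _ := by
  have hp := tensorOverDistrib_points X
  have hn := tensorOverDistrib_natural_left (fun x : Σ _ : ι, PUnit.{1} => X x.1) fun _ => ε
  set R := tensorOverMap (Y := fun x : Σ _ : ι, PUnit.{1} => X x.1)
    (Equiv.sigmaPUnit ι).symm (fun k => 𝟙 (X k))
  have hq : (tensorOverPi fun k => (ε ⊗ₘ tensorOverPUnit fun _ => X k) ≫ (λ_ (X k)).hom) =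
      (tensorOverPi fun k => ε ▷ tensorOver fun _ : PUnit.{1} => X k) ≫
        tensorOverPi fun k => 𝟙_ C ◁ tensorOverPUnit (fun _ => X k) ≫ (λ_ (X k)).hom := by
    rw [← tensorOverPi_comp]
    simp only [MonoidalCategory.tensorHom_def, Category.assoc]
  rw [hq]
  set q := tensorOverPi fun k => 𝟙_ C ◁ tensorOverPUnit (fun _ => X k) ≫ (λ_ (X k)).hom
  calc
    _ = (m ≫ d) ▷ _ ≫ (α_ _ _ _).hom ≫ P ◁ (_ ◁ R ≫ (tensorOverDistrib _ _ ≫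
        tensorOverPi fun k => ε ▷ tensorOver fun _ : PUnit.{1} => X k) ≫ q) := by
      rw [MonoidalCategory.tensorHom_def m]
      simp only [expand, Category.assoc]
      rw [whisker_exchange_assoc]
      simp
    _ = (m ≫ d ≫ P ◁ (tensorOverPi fun _ => ε)) ▷ _ ≫ (α_ _ _ _).hom ≫
        P ◁ (_ ◁ R ≫ tensorOverDistrib _ _ ≫ q) := by
      rw [← hn]
      simp [whisker_exchange_assoc]
    _ = (m ≫ d ≫ P ◁ (tensorOverPi fun _ => ε) ≫ P ◁ tensorOverUnits ι ≫ (ρ_ P).hom) ▷ _ := by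
      rw [hp]
      simp
    _ = _ := by rw [h]; simp

theorem tensorOverPi_point_comp {a b b' : C} (ε : a ⟶ 𝟙_ C) (f : b ⟶ b') :
    a ◁ (tensorOverPi fun _ : PUnit.{1} => f) ≫ (ε ⊗ₘ tensorOverPUnit fun _ => b') ≫
        (λ_ b').hom =
      ((ε ⊗ₘ tensorOverPUnit fun _ => b) ≫ (λ_ b).hom) ≫ f := by
  have h := tensorOverPUnit_natural fun _ => f
  rw [← id_tensorHom, tensorHom_comp_tensorHom_assoc, h, Category.id_comp, Category.assoc,
    ← leftUnitor_naturality, ← id_tensorHom, tensorHom_comp_tensorHom_assoc, Category.comp_id]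

end Expand

section Bottom

variable {C : Type u} [Category.{v} C] [MonoidalCategory C] [SymmetricCategory C]
  {𝒜 : Type u₁} [Category.{v₁} 𝒜]

/-- A morphism of families of families induces a morphism of shapes. -/
def Wreath.shapeMap {W W' : Wreath (Wreath 𝒜)} (f : W ⟶ W') : W.shape ⟶ W'.shape :=
  ⟨f.base, fun s => (f.app s).base⟩

theorem cocompBottom_natural {A : SymSeq C} (Δ : coprod ⋙ A ⟶ odot A A) (B : 𝒜 ⥤ C)
    {W W' : Wreath (Wreath 𝒜)} (f : W ⟶ W') :
    (odot A B).map (merge.map f) ≫ cocompBottom Δ B W' =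
      cocompBottom Δ B W ≫ (odot A (odot A B)).map f :=
  expand_natural (d := Δ.app W.shape) (d' := Δ.app W'.shape)
    (Y' := fun p : Σ s, (W'.fam s).index.carrier => B.obj ((W'.fam p.1).fam p.2))
    (c' := fun s => A.obj (W'.fam s).index)
    f.base.equiv (fun s => (f.app s).base.equiv)
    (fun p => B.map ((f.app p.1).app p.2)) (Δ.naturality (Wreath.shapeMap f))

theorem odotWhisker_comp (A : SymSeq C) {S : FinBij} {b b' b'' : S.carrier → C}
    (f : ∀ s, b s ⟶ b' s) (g : ∀ s, b' s ⟶ b'' s) :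
    (odotWhisker A fun s => f s ≫ g s) = odotWhisker A f ≫ odotWhisker A g :=
  (congrArg (A.obj S ◁ ·) (tensorOverPi_comp f g)).trans
    (MonoidalCategory.whiskerLeft_comp _ _ _)

theorem odotWhisker_id (A : SymSeq C) {S : FinBij} (b : S.carrier → C) :
    (odotWhisker A fun s => 𝟙 (b s)) = 𝟙 _ :=
  (congrArg (A.obj S ◁ ·) (tensorOverPi_id b)).trans (MonoidalCategory.whiskerLeft_id _ _)

/-- The morphism of families over the identity of the index set. -/
def Wreath.homOfFamily {S : FinBij} {W W' : S.carrier → 𝒜} (f : ∀ s, W s ⟶ W' s) :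
    (⟨S, W⟩ : Wreath 𝒜) ⟶ ⟨S, W'⟩ :=
  ⟨𝟙 S, f⟩

theorem odot_map_homOfFamily (A : SymSeq C) (B : 𝒜 ⥤ C) {S : FinBij} {W W' : S.carrier → 𝒜}
    (f : ∀ s, W s ⟶ W' s) :
    (odot A B).map (Wreath.homOfFamily f) = odotWhisker A fun s => B.map (f s) := by
  change A.map (𝟙 S) ⊗ₘ _ = _
  rw [A.map_id, id_tensorHom]
  rfl

theorem odotWhisker_comp_cocompBottom {A : SymSeq C} (Δ : coprod ⋙ A ⟶ odot A A)
    {ℬ : Type*} [Category* ℬ] (B : 𝒜 ⥤ C) (B' : ℬ ⥤ C) (W : Wreath (Wreath ℬ)) (P : ℬ → 𝒜)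
    (f : ∀ b, B.obj (P b) ⟶ B'.obj b) :
    (odotWhisker A (S := coprod.obj W.shape) fun p : Σ s, (W.fam s).index.carrier =>
        f ((W.fam p.1).fam p.2)) ≫ cocompBottom Δ B' W =
      cocompBottom Δ B ⟨W.index, fun s => ⟨(W.fam s).index, fun t => P ((W.fam s).fam t)⟩⟩ ≫
        odotWhisker A (S := W.index) fun s => odotWhisker A fun t => f ((W.fam s).fam t) :=
  expand_natural_pi (β := fun s => (W.fam s).index.carrier) (Δ.app W.shape)
    fun p => f ((W.fam p.1).fam p.2)

/-- The canonical reassociation of triply nested families. -/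
def mergeAssoc (W : Wreath (Wreath (Wreath 𝒜))) :
    merge.obj ((Wreath.map merge).obj W) ⟶ merge.obj (merge.obj W) :=
  ⟨⟨(Equiv.sigmaAssoc fun (s : W.index.carrier) (t : (W.fam s).index.carrier) =>
    ((W.fam s).fam t).index.carrier).symm⟩, fun _ => 𝟙 _⟩

/-- The shape of triply nested families, as doubly nested families of sets. -/
def Wreath.doubleShape (W : Wreath (Wreath (Wreath 𝒜))) : Wreath (Wreath FinBij) :=
  ⟨W.index, fun s => (W.fam s).shape⟩

theorem cocompBottom_coassoc {A : SymSeq C} {Δ : coprod ⋙ A ⟶ odot A A}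
    (h : IsCoassociative Δ Δ) (B : 𝒜 ⥤ C) (W : Wreath (Wreath (Wreath 𝒜))) :
    (odot A B).map (mergeAssoc W) ≫ cocompBottom Δ B (merge.obj W) ≫
        cocompBottom Δ (odot A B) W =
      cocompBottom Δ B ((Wreath.map merge).obj W) ≫
        odotWhisker A (S := W.index) fun s => cocompBottom Δ B (W.fam s) := by
  have hW := expand_expand (ι := W.index.carrier) (β := fun s => (W.fam s).index.carrier)
    (δ := fun s t => ((W.fam s).fam t).index.carrier) (m := A.map (coprodAssoc W.doubleShape))
    (d₁ := Δ.app (merge.obj W.doubleShape)) (d₂ := Δ.app W.doubleShape.shape)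
    (d₃ := Δ.app ((Wreath.map coprod).obj W.doubleShape))
    (d₄ := fun s => Δ.app (W.doubleShape.fam s)) (h W.doubleShape)
    (fun x : Σ p : Σ s, (W.fam s).index.carrier, ((W.fam p.1).fam p.2).index.carrier =>
      B.obj (((W.fam x.1.1).fam x.1.2).fam x.2))
  refine Eq.trans (congrArg (· ≫ _) ?_) hW
  exact congrArg (A.map (mergeAssoc W).base ⊗ₘ ·) (congrArg (tensorOverMap _)
    (funext fun x => B.map_id _))

/-- The canonical isomorphism of a family with the merged one-element family of it. -/
def mergeSingle (W : Wreath 𝒜) : W ⟶ merge.obj (singleFam.obj W) :=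
  ⟨sigmaPoint W.index, fun s => 𝟙 (W.fam s)⟩

/-- The canonical isomorphism of a family with the merged family of its one-element families. -/
def mergeSingles (W : Wreath 𝒜) : W ⟶ merge.obj ((Wreath.map singleFam).obj W) :=
  ⟨sigmaPoints W.index, fun s => 𝟙 (W.fam s)⟩

variable [HasLimitsOfSize.{0, 0} C]

theorem odotWhisker_comp_counitBottom {A : SymSeq C} (ε : A ⟶ counitSeq C) {ℬ : Type*}
    [Category* ℬ] (B : 𝒜 ⥤ C) (B' : ℬ ⥤ C) {a : 𝒜} {b : ℬ} (f : B.obj a ⟶ B'.obj b) :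
    (odotWhisker A (S := FinBij.point) fun _ => f) ≫ counitBottom ε B' b =
      counitBottom ε B a ≫ f :=
  tensorOverPi_point_comp (ε.app FinBij.point ≫ counitSeqPoint) f

theorem cocompBottom_left_counit {A : SymSeq C} {Δ : coprod ⋙ A ⟶ odot A A}
    {ε : A ⟶ counitSeq C} (h : IsLeftCounital ε Δ) (B : 𝒜 ⥤ C) (W : Wreath 𝒜) :
    (odot A B).map (mergeSingle W) ≫ cocompBottom Δ B (singleFam.obj W) ≫
      counitBottom ε (odot A B) W = 𝟙 _ := by
  have hW := expand_point (β := W.index.carrier) (c := fun _ => A.obj W.index)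
    (m := A.map (sigmaPoint W.index)) (d := Δ.app (singleFam.obj W.index))
    (ε := ε.app FinBij.point ≫ counitSeqPoint) (h W.index) (fun x => B.obj (W.fam x.2))
  refine Eq.trans (congrArg (· ≫ _) ?_) hW
  exact congrArg (A.map (sigmaPoint W.index) ⊗ₘ ·) (congrArg (tensorOverMap _)
    (funext fun x => B.map_id _))

theorem cocompBottom_right_counit {A : SymSeq C} {Δ : coprod ⋙ A ⟶ odot A A}
    {ε : A ⟶ counitSeq C} (h : IsRightCounital ε Δ) (B : 𝒜 ⥤ C) (W : Wreath 𝒜) :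
    (odot A B).map (mergeSingles W) ≫ cocompBottom Δ B ((Wreath.map singleFam).obj W) ≫
      (odotWhisker A (S := W.index) fun s => counitBottom ε B (W.fam s)) = 𝟙 _ := by
  have hW := expand_points (ι := W.index.carrier) (a := A.obj FinBij.point)
    (m := A.map (sigmaPoints W.index)) (d := Δ.app ⟨W.index, fun _ => FinBij.point⟩)
    (ε := ε.app FinBij.point ≫ counitSeqPoint) (h W.index) (fun s => B.obj (W.fam s))
  refine Eq.trans (congrArg (· ≫ _) ?_) hW
  exact congrArg (A.map (sigmaPoints W.index) ⊗ₘ ·) (congrArg (tensorOverMap _)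
    (funext fun x => B.map_id _))

end Bottom

/-! ### Morphisms of right Kan extensions induced at the level of wreath categories -/

section Kan

variable {C : Type u} [Category.{v} C] [HasLimitsOfSize.{0, 0} C]

theorem kan_hom_ext (n : ℕ) (F : Level n ⥤ C) {A : SymSeq C} {d d' : A ⟶ kan n F}
    (h : ∀ W, d.app ((gamma n).obj W) ≫ (kanCounit n F).app W =
      d'.app ((gamma n).obj W) ≫ (kanCounit n F).app W) : d = d' :=
  (gamma n).hom_ext_of_isRightKanExtension (F' := (gamma n).rightKanExtension F)
    ((gamma n).rightKanExtensionCounit F) d d' (NatTrans.ext (funext h))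

theorem kan_exists_lift (n : ℕ) (F : Level n ⥤ C) {A : SymSeq C} (τ : gamma n ⋙ A ⟶ F) :
    ∃ d : A ⟶ kan n F, ∀ W,
      d.app ((gamma n).obj W) ≫ (kanCounit n F).app W = τ.app W :=
  ⟨((gamma n).rightKanExtension F).liftOfIsRightKanExtension
    ((gamma n).rightKanExtensionCounit F) A τ,
    ((gamma n).rightKanExtension F).liftOfIsRightKanExtension_fac_app _ A τ⟩

end Kan

section LevelMaps

variable {C : Type u} [Category.{v} C] [MonoidalCategory C] [SymmetricCategory C]
  [HasLimitsOfSize.{0, 0} C] {O : Cooperad C} (M : LeftComodule O)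

/-- The data at the level of wreath categories that induces a morphism
`O^{∘̂ n} ∘̂ M ⟶ O^{∘̂ m} ∘̂ M` of right Kan extensions. Naturality in `W` is not
part of the data. -/
structure LevelMap (n m : ℕ) where
  obj : Level m → Level n
  bij : ∀ W, (gamma m).obj W ⟶ (gamma n).obj (obj W)
  app : ∀ W, (M.iter n).obj (obj W) ⟶ (M.iter m).obj W

namespace LevelMap

variable {M} {n m k : ℕ}

/-- `d` is a morphism of right Kan extensions compatible with `S`. -/
def Induces (S : LevelMap M n m) (d : M.compProd n ⟶ M.compProd m) : Prop :=
  ∀ W, d.app ((gamma m).obj W) ≫ (M.iota m).app W =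
    (M.compProd n).map (S.bij W) ≫ (M.iota n).app (S.obj W) ≫ S.app W

variable (M n) in
/-- The identity level map. -/
protected def id : LevelMap M n n := ⟨fun W => W, fun _ => 𝟙 _, fun _ => 𝟙 _⟩

/-- Composition of level maps, in diagrammatic order. -/
def comp (S : LevelMap M n m) (T : LevelMap M m k) : LevelMap M n k where
  obj W := S.obj (T.obj W)
  bij W := T.bij W ≫ S.bij (T.obj W)
  app W := S.app (T.obj W) ≫ T.app W

/-- The application of a level map to all members of a family, that is, below an additional
outermost factor `O`. -/
def succ (S : LevelMap M n m) : LevelMap M (n + 1) (m + 1) where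
  obj W := ⟨W.index, fun s => S.obj (W.fam s)⟩
  bij W := ⟨Equiv.sigmaCongrRight fun s => (S.bij (W.fam s)).equiv⟩
  app W := odotWhisker O.seq (S := W.index) fun s => S.app (W.fam s)

/-- Two level maps that agree up to an isomorphism of their object parts. -/
def Equivalent (S T : LevelMap M n m) : Prop :=
  ∀ W, ∃ θ : S.obj W ⟶ T.obj W, S.bij W ≫ (gamma n).map θ = T.bij W ∧
    S.app W = (M.iter n).map θ ≫ T.app W

theorem succ_comp (S : LevelMap M n m) (T : LevelMap M m k) :
    (S.comp T).succ = S.succ.comp T.succ := by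
  have h : (S.comp T).succ.app = (S.succ.comp T.succ).app :=
    funext fun W => odotWhisker_comp O.seq _ _
  exact congrArg (LevelMap.mk (S.comp T).succ.obj (S.comp T).succ.bij) h

theorem succ_id : (LevelMap.id M n).succ = LevelMap.id M (n + 1) := by
  have h : (LevelMap.id M n).succ.app = (LevelMap.id M (n + 1)).app :=
    funext fun W => odotWhisker_id O.seq _
  exact congrArg (LevelMap.mk (LevelMap.id M n).succ.obj (LevelMap.id M n).succ.bij) h

theorem Equivalent.succ {S T : LevelMap M n m} (h : S.Equivalent T) :
    S.succ.Equivalent T.succ := by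
  intro W
  choose θ h₁ h₂ using h
  refine ⟨Wreath.homOfFamily fun s => θ (W.fam s), ?_, ?_⟩
  · refine FinBij.Hom.ext (Equiv.ext fun x => ?_)
    have := congrArg (fun g => g.equiv x.2) (h₁ (W.fam x.1))
    exact congrArg (Sigma.mk x.1) this
  · have e : (M.iter (n + 1)).map (Wreath.homOfFamily fun s => θ (W.fam s)) =
        odotWhisker O.seq fun s => (M.iter n).map (θ (W.fam s)) :=
      odot_map_homOfFamily O.seq (M.iter n) _
    refine Eq.trans ?_ (congrArg (· ≫ T.succ.app W) e.symm)
    refine Eq.trans ?_ (odotWhisker_comp O.seq _ _)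
    exact congrArg (odotWhisker O.seq) (funext fun s => h₂ (W.fam s))

theorem Induces.of_equivalent {S T : LevelMap M n m} (h : S.Equivalent T)
    {d : M.compProd n ⟶ M.compProd m} (hd : T.Induces d) : S.Induces d := by
  intro W
  obtain ⟨θ, h₁, h₂⟩ := h W
  have := (M.iota n).naturality θ
  dsimp at this
  rw [hd W, h₂, ← h₁, Functor.map_comp, Category.assoc, reassoc_of% this]

theorem Induces.comp {S : LevelMap M n m} {T : LevelMap M m k}
    {d : M.compProd n ⟶ M.compProd m} {d' : M.compProd m ⟶ M.compProd k}
    (hS : S.Induces d) (hT : T.Induces d') : (S.comp T).Induces (d ≫ d') := by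
  intro W
  have h := d.naturality (T.bij W)
  simp only [LevelMap.comp, NatTrans.comp_app, Category.assoc, Functor.map_comp]
  rw [hT W, ← reassoc_of% h, reassoc_of% (hS (T.obj W))]

theorem induces_id : (LevelMap.id M n).Induces (𝟙 _) := by
  intro W
  simp [LevelMap.id]

end LevelMap

namespace LeftComodule

theorem hom_ext (n : ℕ) {A : SymSeq C} {d d' : A ⟶ M.compProd n}
    (h : ∀ W, d.app ((gamma n).obj W) ≫ (M.iota n).app W =
      d'.app ((gamma n).obj W) ≫ (M.iota n).app W) : d = d' := by
  cases n with
  | zero =>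
    exact NatTrans.ext (funext fun W =>
      (Category.comp_id _).symm.trans ((h W).trans (Category.comp_id _)))
  | succ n => exact kan_hom_ext (n + 1) (M.iter (n + 1)) h

theorem exists_lift (n : ℕ) {A : SymSeq C} (τ : gamma n ⋙ A ⟶ M.iter n) :
    ∃ d : A ⟶ M.compProd n, ∀ W,
      d.app ((gamma n).obj W) ≫ (M.iota n).app W = τ.app W := by
  cases n with
  | zero =>
    exact ⟨(Functor.leftUnitor A).inv ≫ τ, fun W =>
      (Category.comp_id _).trans (Category.id_comp (τ.app W))⟩
  | succ n => exact kan_exists_lift (n + 1) (M.iter (n + 1)) τ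

end LeftComodule

end LevelMaps

section Naturality

theorem gammaFace_natural : ∀ (n : ℕ) (i : Fin (n + 1)) {W W' : Level (n + 1)} (f : W ⟶ W'),
    (gamma (n + 1)).map f ≫ gammaFace n i W' =
      gammaFace n i W ≫ (gamma n).map ((face n i).map f)
  | 0 => fun _ W W' f => rfl
  | n + 1 => by
    refine Fin.cases ?_ ?_
    · intro W W' f
      exact FinBij.Hom.ext (Equiv.ext fun x => rfl)
    · intro i W W' f
      refine FinBij.Hom.ext (Equiv.ext fun x => ?_)
      have h := congrArg (fun g => g.equiv x.2) (gammaFace_natural n i (f.app x.1))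
      exact congrArg (Sigma.mk (f.base.equiv x.1)) h

theorem sigmaPoint_natural {S T : FinBij} (f : S ⟶ T) :
    f ≫ sigmaPoint T = sigmaPoint S ≫ (singleFam ⋙ coprod).map f :=
  FinBij.Hom.ext (Equiv.ext fun _ => rfl)

theorem gammaDegen_natural : ∀ (n : ℕ) (j : Fin (n + 1)) {W W' : Level n} (f : W ⟶ W'),
    (gamma n).map f ≫ gammaDegen n j W' =
      gammaDegen n j W ≫ (gamma (n + 1)).map ((degen n j).map f)
  | 0 => fun _ W W' f => sigmaPoint_natural f
  | n + 1 => by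
    refine Fin.cases ?_ ?_
    · intro W W' f
      exact sigmaPoint_natural ((gamma (n + 1)).map f)
    · intro j W W' f
      refine FinBij.Hom.ext (Equiv.ext fun x => ?_)
      have h := congrArg (fun g => g.equiv x.2) (gammaDegen_natural n j (f.app x.1))
      exact congrArg (Sigma.mk (f.base.equiv x.1)) h

theorem tensorHom_comp_whiskerLeft_eq {C : Type u} [Category.{v} C] [MonoidalCategory C]
    {P P' T₁ T₂ T₃ T₄ : C} (a : P ⟶ P') {x : T₁ ⟶ T₂} {y : T₂ ⟶ T₄} {x' : T₁ ⟶ T₃} {y' : T₃ ⟶ T₄}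
    (h : x ≫ y = x' ≫ y') : (a ⊗ₘ x) ≫ P' ◁ y = P ◁ x' ≫ (a ⊗ₘ y') := by
  rw [← id_tensorHom, ← id_tensorHom, tensorHom_comp_tensorHom, tensorHom_comp_tensorHom, h,
    Category.comp_id, Category.id_comp]

variable {C : Type u} [Category.{v} C] [MonoidalCategory C] [SymmetricCategory C]

theorem odotWhisker_natural {𝒜 : Type u₁} [Category.{v₁} 𝒜] {ℬ : Type u₂} [Category.{v₂} ℬ]
    (A : SymSeq C) {B : 𝒜 ⥤ C} {B' : ℬ ⥤ C} {P : ℬ ⥤ 𝒜} {φ : ∀ b, B.obj (P.obj b) ⟶ B'.obj b}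
    (hφ : ∀ {b b' : ℬ} (f : b ⟶ b'), B.map (P.map f) ≫ φ b' = φ b ≫ B'.map f)
    {W W' : Wreath ℬ} (f : W ⟶ W') :
    (odot A B).map ((Wreath.map P).map f) ≫
        (odotWhisker A (S := W'.index) fun s => φ (W'.fam s)) =
      (odotWhisker A (S := W.index) fun s => φ (W.fam s)) ≫ (odot A B').map f := by
  have h₁ := tensorOverMap_comp (Z := fun s => B'.obj (W'.fam s)) f.base.equiv
    (Equiv.refl W'.index.carrier) (fun s => B.map (P.map (f.app s))) fun s => φ (W'.fam s)
  have h₂ := tensorOverMap_comp (Z := fun s => B'.obj (W'.fam s)) (Equiv.refl W.index.carrier)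
    f.base.equiv (fun s => φ (W.fam s)) fun s => B'.map (f.app s)
  have h₃ : (fun s => B.map (P.map (f.app s)) ≫ φ (W'.fam (f.base.equiv s))) =
    fun s => φ (W.fam s) ≫ B'.map (f.app s) := funext fun s => hφ (f.app s)
  have h₄ := h₁.symm.trans ((congrArg (tensorOverMap f.base.equiv) h₃).trans h₂)
  exact tensorHom_comp_whiskerLeft_eq _ h₄

variable [HasLimitsOfSize.{0, 0} C]

theorem counitBottom_natural {𝒜 : Type u₁} [Category.{v₁} 𝒜] {A : SymSeq C} (ε : A ⟶ counitSeq C)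
    (B : 𝒜 ⥤ C) {a a' : 𝒜} (f : a ⟶ a') :
    (odot A B).map (singleFam.map f) ≫ counitBottom ε B a' = counitBottom ε B a ≫ B.map f :=
  (congrArg (· ≫ _) (odot_map_homOfFamily A B (S := FinBij.point) fun _ => f)).trans
    (odotWhisker_comp_counitBottom ε B B (B.map f))

variable {O : Cooperad C} (M : LeftComodule O)

namespace LeftComodule

theorem cofaceApp_natural : ∀ (n : ℕ) (i : Fin (n + 1)) {W W' : Level (n + 1)} (f : W ⟶ W'),
    (M.iter n).map ((face n i).map f) ≫ M.cofaceApp n i W' =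
      M.cofaceApp n i W ≫ (M.iter (n + 1)).map f
  | 0 => fun _ W W' f => M.coact.naturality f
  | n + 1 => by
    refine Fin.cases ?_ ?_
    · intro W W' f
      exact cocompBottom_natural O.cocomp (M.iter n) f
    · intro i W W' f
      exact odotWhisker_natural O.seq (fun g => cofaceApp_natural n i g) f

theorem codegenApp_natural : ∀ (n : ℕ) (j : Fin (n + 1)) {W W' : Level n} (f : W ⟶ W'),
    (M.iter (n + 1)).map ((degen n j).map f) ≫ M.codegenApp n j W' =
      M.codegenApp n j W ≫ (M.iter n).map f
  | 0 => fun _ W W' f => counitBottom_natural O.counit (M.iter 0) f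
  | n + 1 => by
    refine Fin.cases ?_ ?_
    · intro W W' f
      exact counitBottom_natural O.counit (M.iter (n + 1)) f
    · intro i W W' f
      exact odotWhisker_natural O.seq (fun g => codegenApp_natural n i g) f

theorem existsUnique_induces {n m : ℕ} (P : Level m ⥤ Level n)
    (g : ∀ W, (gamma m).obj W ⟶ (gamma n).obj (P.obj W))
    (φ : ∀ W, (M.iter n).obj (P.obj W) ⟶ (M.iter m).obj W)
    (hg : ∀ {W W'} (f : W ⟶ W'), (gamma m).map f ≫ g W' = g W ≫ (gamma n).map (P.map f))
    (hφ : ∀ {W W'} (f : W ⟶ W'), (M.iter n).map (P.map f) ≫ φ W' = φ W ≫ (M.iter m).map f) :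
    ∃! d, (LevelMap.mk P.obj g φ).Induces d := by
  obtain ⟨d, hd⟩ := M.exists_lift m (A := M.compProd n)
    { app W := (M.compProd n).map (g W) ≫ (M.iota n).app (P.obj W) ≫ φ W
      naturality W W' f := by
        have := (M.iota n).naturality (P.map f)
        dsimp at this ⊢
        rw [← Functor.map_comp_assoc, hg, Functor.map_comp_assoc, reassoc_of% this, hφ]
        simp }
  refine ⟨d, hd, fun d' hd' => M.hom_ext m fun W => ?_⟩
  exact (hd' W).trans (hd W).symm

theorem existsUnique_isCoface (n : ℕ) (i : Fin (n + 1)) : ∃! d, M.IsCoface n i d :=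
  M.existsUnique_induces (face n i) (gammaFace n i) (M.cofaceApp n i) (gammaFace_natural n i)
    (M.cofaceApp_natural n i)

theorem existsUnique_isCodegen (n : ℕ) (j : Fin (n + 1)) : ∃! s, M.IsCodegen n j s :=
  M.existsUnique_induces (degen n j) (gammaDegen n j) (M.codegenApp n j) (gammaDegen_natural n j)
    (M.codegenApp_natural n j)

end LeftComodule

end Naturality

/-! ### The cosimplicial identities -/

section Identities

theorem gamma_map_id_apply (n : ℕ) {W : Level n} (x : ((gamma n).obj W).carrier) :
    ((gamma n).map (𝟙 W)).equiv x = x := by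
  rw [(gamma n).map_id]
  rfl

variable {C : Type u} [Category.{v} C] [MonoidalCategory C] [SymmetricCategory C]
  [HasLimitsOfSize.{0, 0} C] {O : Cooperad C} (M : LeftComodule O)

namespace LevelMap

/-- The level map inducing the coface `Δᵢ₊₁`. -/
def coface (n : ℕ) (i : Fin (n + 1)) : LevelMap M n (n + 1) :=
  ⟨(face n i).obj, gammaFace n i, M.cofaceApp n i⟩

/-- The level map inducing the codegeneracy `εⱼ`. -/
def codegen (n : ℕ) (j : Fin (n + 1)) : LevelMap M (n + 1) n :=
  ⟨(degen n j).obj, gammaDegen n j, M.codegenApp n j⟩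

theorem codegen_zero (n : ℕ) :
    codegen M n 0 = ⟨fun W => (singleFam (𝒜 := Level n)).obj W,
      fun W => sigmaPoint ((gamma n).obj W), counitBottom O.counit (M.iter n)⟩ := by
  cases n <;> rfl

variable {M} {n m : ℕ}

theorem coface_zero_comp_succ_succ (S : LevelMap M n m) :
    (coface M (n + 1) 0).comp S.succ.succ = S.succ.comp (coface M (m + 1) 0) := by
  have h : ((coface M (n + 1) 0).comp S.succ.succ).app = (S.succ.comp (coface M (m + 1) 0)).app :=
    funext fun W =>
      (odotWhisker_comp_cocompBottom O.cocomp (M.iter n) (M.iter m) W S.obj S.app).symm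
  exact congrArg (LevelMap.mk ((coface M (n + 1) 0).comp S.succ.succ).obj
    ((coface M (n + 1) 0).comp S.succ.succ).bij) h

theorem codegen_zero_comp (S : LevelMap M n m) :
    (codegen M n 0).comp S = S.succ.comp (codegen M m 0) := by
  rw [codegen_zero, codegen_zero]
  have h : ∀ W, counitBottom O.counit (M.iter n) (S.obj W) ≫ S.app W =
      (odotWhisker O.seq (S := FinBij.point) fun _ => S.app W) ≫
        counitBottom O.counit (M.iter m) W := fun W =>
      (odotWhisker_comp_counitBottom O.counit (M.iter n) (M.iter m) (S.app W)).symm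
  exact congrArg (LevelMap.mk (n := n + 1) (m := m) (fun W => singleFam.obj (S.obj W))
    fun W => S.bij W ≫ sigmaPoint ((gamma n).obj (S.obj W))) (funext h)

theorem Equivalent.of_eq {S T : LevelMap M n m} (h : S = T) : S.Equivalent T := by
  subst h
  exact fun W => ⟨𝟙 _, by simp, by simp⟩

theorem coface_comp_coface : ∀ {n : ℕ} {i j : Fin (n + 1)}, i ≤ j →
    ((coface M n i).comp (coface M (n + 1) j.succ)).Equivalent
      ((coface M n j).comp (coface M (n + 1) i.castSucc))
  | 0, i, j, _ => by
    obtain rfl : i = 0 := Fin.eq_zero i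
    obtain rfl : j = 0 := Fin.eq_zero j
    exact fun W => ⟨coprodAssoc W, FinBij.Hom.ext (Equiv.ext fun _ => rfl), (M.coassoc W).symm⟩
  | n + 1, i, j, h => by
    induction i using Fin.cases with
    | zero =>
      induction j using Fin.cases with
      | zero =>
        exact fun W => ⟨mergeAssoc (𝒜 := Level n) W,
          FinBij.Hom.ext (Equiv.ext fun x => congrArg (Sigma.mk _) (gamma_map_id_apply n x.2.2.2)),
          (cocompBottom_coassoc O.coassoc (M.iter n) W).symm⟩
      | succ j =>
        exact .of_eq (coface_zero_comp_succ_succ (coface M n j))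
    | succ i =>
      induction j using Fin.cases with
      | zero => exact absurd h (by simp)
      | succ j =>
        have := (coface_comp_coface (Fin.succ_le_succ_iff.1 h)).succ
        rw [succ_comp, succ_comp] at this
        exact this

theorem codegen_comp_codegen : ∀ {n : ℕ} {i j : Fin (n + 1)}, i ≤ j →
    (codegen M (n + 1) i.castSucc).comp (codegen M n j) =
      (codegen M (n + 1) j.succ).comp (codegen M n i)
  | 0, i, j, _ => by
    obtain rfl : i = 0 := Fin.eq_zero i
    exact codegen_zero_comp (codegen M 0 j)
  | n + 1, i, j, h => by
    induction i using Fin.cases with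
    | zero => exact codegen_zero_comp (codegen M (n + 1) j)
    | succ i =>
      induction j using Fin.cases with
      | zero => exact absurd h (by simp)
      | succ j =>
        have := congrArg succ (codegen_comp_codegen (Fin.succ_le_succ_iff.1 h))
        rw [succ_comp, succ_comp] at this
        exact this

theorem coface_comp_codegen_self : ∀ {n : ℕ} (i : Fin (n + 1)),
    (LevelMap.id M n).Equivalent ((coface M n i).comp (codegen M n i))
  | 0, i => by
    obtain rfl : i = 0 := Fin.eq_zero i
    exact fun W => ⟨sigmaPoint W, FinBij.Hom.ext (Equiv.ext fun _ => rfl), (M.left_counit W).symm⟩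
  | n + 1, i => by
    induction i using Fin.cases with
    | zero =>
      exact fun W => ⟨mergeSingle (𝒜 := Level n) W,
        FinBij.Hom.ext (Equiv.ext fun x => congrArg (Sigma.mk _) (gamma_map_id_apply n x.2)),
        (cocompBottom_left_counit O.left_counit (M.iter n) W).symm⟩
    | succ i =>
      have := (coface_comp_codegen_self i).succ
      rw [succ_comp, succ_id] at this
      exact this

theorem coface_comp_codegen_succ : ∀ {n : ℕ} (i : Fin (n + 1)),
    (LevelMap.id M (n + 1)).Equivalent
      ((coface M (n + 1) i.castSucc).comp (codegen M (n + 1) i.succ)) := by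
  have h₀ : ∀ n : ℕ, (LevelMap.id M (n + 1)).Equivalent
      ((coface M (n + 1) 0).comp (codegen M n 0).succ) := by
    intro n
    rw [codegen_zero]
    exact fun W => ⟨mergeSingles (𝒜 := Level n) W,
      FinBij.Hom.ext (Equiv.ext fun x => congrArg (Sigma.mk _) (gamma_map_id_apply n x.2)),
      (cocompBottom_right_counit O.right_counit (M.iter n) W).symm⟩
  intro n
  induction n with
  | zero =>
    intro i
    obtain rfl : i = 0 := Fin.eq_zero i
    exact h₀ 0
  | succ n ih =>
    intro i
    induction i using Fin.cases with
    | zero => exact h₀ (n + 1)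
    | succ i =>
      have := (ih i).succ
      rw [succ_comp, succ_id] at this
      exact this

theorem coface_succ_comp_codegen : ∀ {n : ℕ} {i j : Fin (n + 1)}, j ≤ i →
    (coface M (n + 1) i.succ).comp (codegen M (n + 1) j.castSucc) =
      (codegen M n j).comp (coface M n i)
  | 0, i, j, _ => by
    obtain rfl : j = 0 := Fin.eq_zero j
    exact (codegen_zero_comp (coface M 0 i)).symm
  | n + 1, i, j, h => by
    induction j using Fin.cases with
    | zero => exact (codegen_zero_comp (coface M (n + 1) i)).symm
    | succ j =>
      induction i using Fin.cases with
      | zero => exact absurd h (by simp)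
      | succ i =>
        have := congrArg succ (coface_succ_comp_codegen (Fin.succ_le_succ_iff.1 h))
        rw [succ_comp, succ_comp] at this
        exact this

theorem coface_castSucc_comp_codegen : ∀ {n : ℕ} {i j : Fin (n + 1)}, i < j →
    (coface M (n + 1) i.castSucc).comp (codegen M (n + 1) j.succ) =
      (codegen M n j).comp (coface M n i)
  | 0, i, j, h => absurd h (by omega)
  | n + 1, i, j, h => by
    induction j using Fin.cases with
    | zero => exact absurd h (by simp)
    | succ j =>
      induction i using Fin.cases with
      | zero => exact coface_zero_comp_succ_succ (codegen M n j)
      | succ i =>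
        have := congrArg succ (coface_castSucc_comp_codegen (Fin.succ_lt_succ_iff.1 h))
        rw [succ_comp, succ_comp] at this
        exact this

end LevelMap

namespace LeftComodule

/-- The coface `Δᵢ₊₁ : O^{∘̂ n} ∘̂ M ⟶ O^{∘̂ (n+1)} ∘̂ M`. -/
def coface (n : ℕ) (i : Fin (n + 1)) : M.compProd n ⟶ M.compProd (n + 1) :=
  (M.existsUnique_isCoface n i).choose

/-- The codegeneracy `εⱼ : O^{∘̂ (n+1)} ∘̂ M ⟶ O^{∘̂ n} ∘̂ M`. -/
def codegen (n : ℕ) (j : Fin (n + 1)) : M.compProd (n + 1) ⟶ M.compProd n :=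
  (M.existsUnique_isCodegen n j).choose

theorem isCoface_coface (n : ℕ) (i : Fin (n + 1)) : M.IsCoface n i (M.coface n i) :=
  (M.existsUnique_isCoface n i).choose_spec.1

theorem isCodegen_codegen (n : ℕ) (j : Fin (n + 1)) : M.IsCodegen n j (M.codegen n j) :=
  (M.existsUnique_isCodegen n j).choose_spec.1

theorem induces_coface (n : ℕ) (i : Fin (n + 1)) :
    (LevelMap.coface M n i).Induces (M.coface n i) :=
  M.isCoface_coface n i

theorem induces_codegen (n : ℕ) (j : Fin (n + 1)) :
    (LevelMap.codegen M n j).Induces (M.codegen n j) :=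
  M.isCodegen_codegen n j

variable {M} in
theorem eq_of_induces {n m : ℕ} {S T : LevelMap M n m} (h : S.Equivalent T)
    {d d' : M.compProd n ⟶ M.compProd m} (hd : S.Induces d) (hd' : T.Induces d') : d = d' :=
  M.hom_ext m fun W => (hd W).trans (hd'.of_equivalent h W).symm

theorem coface_comp_coface {n : ℕ} {i j : Fin (n + 1)} (h : i ≤ j) :
    M.coface n i ≫ M.coface (n + 1) j.succ = M.coface n j ≫ M.coface (n + 1) i.castSucc :=
  eq_of_induces (LevelMap.coface_comp_coface h)
    ((M.induces_coface _ _).comp (M.induces_coface _ _))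
    ((M.induces_coface _ _).comp (M.induces_coface _ _))

theorem codegen_comp_codegen {n : ℕ} {i j : Fin (n + 1)} (h : i ≤ j) :
    M.codegen (n + 1) i.castSucc ≫ M.codegen n j = M.codegen (n + 1) j.succ ≫ M.codegen n i :=
  eq_of_induces (.of_eq (LevelMap.codegen_comp_codegen h))
    ((M.induces_codegen _ _).comp (M.induces_codegen _ _))
    ((M.induces_codegen _ _).comp (M.induces_codegen _ _))

theorem coface_comp_codegen_self {n : ℕ} (i : Fin (n + 1)) :
    M.coface n i ≫ M.codegen n i = 𝟙 _ :=
  (eq_of_induces (LevelMap.coface_comp_codegen_self i) LevelMap.induces_id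
    ((M.induces_coface _ _).comp (M.induces_codegen _ _))).symm

theorem coface_comp_codegen_succ {n : ℕ} (i : Fin (n + 1)) :
    M.coface (n + 1) i.castSucc ≫ M.codegen (n + 1) i.succ = 𝟙 _ :=
  (eq_of_induces (LevelMap.coface_comp_codegen_succ i) LevelMap.induces_id
    ((M.induces_coface _ _).comp (M.induces_codegen _ _))).symm

theorem coface_succ_comp_codegen {n : ℕ} {i j : Fin (n + 1)} (h : j ≤ i) :
    M.coface (n + 1) i.succ ≫ M.codegen (n + 1) j.castSucc = M.codegen n j ≫ M.coface n i :=
  eq_of_induces (.of_eq (LevelMap.coface_succ_comp_codegen h))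
    ((M.induces_coface _ _).comp (M.induces_codegen _ _))
    ((M.induces_codegen _ _).comp (M.induces_coface _ _))

theorem coface_castSucc_comp_codegen {n : ℕ} {i j : Fin (n + 1)} (h : i < j) :
    M.coface (n + 1) i.castSucc ≫ M.codegen (n + 1) j.succ = M.codegen n j ≫ M.coface n i :=
  eq_of_induces (.of_eq (LevelMap.coface_castSucc_comp_codegen h))
    ((M.induces_coface _ _).comp (M.induces_codegen _ _))
    ((M.induces_codegen _ _).comp (M.induces_coface _ _))

end LeftComodule

end Identities

/-! ### The presentation of the simplex category by generators and relations -/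

section SimplexPresentation

open SimplexCategoryGenRel

theorem P_σ_eq_of_map_eq {x y : SimplexCategoryGenRel} {f g : x ⟶ y} (hf : P_σ f) (hg : P_σ g)
    (h : toSimplexCategory.map f = toSimplexCategory.map g) : f = g := by
  obtain ⟨L, m, b, rfl, rfl, rfl, hL, rfl⟩ := exists_normal_form_P_σ f hf
  obtain ⟨L', m', b', hy, hx, rfl, hL', rfl⟩ := exists_normal_form_P_σ g hg
  obtain rfl : m' = m := congrArg len hy
  have hlen : L.length = L'.length := Nat.add_left_cancel (congrArg len hx)
  have heval : ∀ j < m' + L.length + 1, simplicialEvalσ L j = simplicialEvalσ L' j := fun j hj =>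
    (simplicialEvalσ_of_isAdmissible L _ _ hL rfl j hj).symm.trans <|
      (congrArg (fun φ => (φ.toOrderHom ⟨j, hj⟩ : ℕ)) h).trans <|
        simplicialEvalσ_of_isAdmissible L' _ _ hL' (congrArg len hx).symm j hj
  obtain rfl : L = L' := hL.sortedLT.eq_of_mem_iff hL'.sortedLT fun j => by
    rw [mem_isAdmissible_iff L hL, mem_isAdmissible_iff L' hL', hlen]
    refine and_congr_right fun hj => ?_
    rw [heval j (by omega), heval (j + 1) (by omega)]
  rfl

theorem δ_comp_δ_swap {n : ℕ} (i : Fin (n + 2)) (k : Fin (n + 3)) :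
    δ i ≫ δ k = δ (i.predAbove k) ≫ δ (k.succAbove i) := by
  obtain h | h := lt_or_ge i.castSucc k
  · obtain ⟨k, rfl⟩ := Fin.eq_succ_of_ne_zero (Fin.ne_zero_of_lt h)
    rw [Fin.succAbove_of_castSucc_lt _ _ h, Fin.predAbove_of_castSucc_lt _ _ h, Fin.pred_succ,
      δ_comp_δ (Fin.castSucc_lt_succ_iff.1 h)]
  · obtain ⟨k, rfl⟩ := Fin.eq_castSucc_of_ne_last
      (Fin.ne_last_of_lt (h.trans_lt (Fin.castSucc_lt_last i)))
    rw [Fin.succAbove_of_le_castSucc _ _ h, Fin.predAbove_of_le_castSucc _ _ h,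
      Fin.castPred_castSucc, δ_comp_δ (Fin.castSucc_le_castSucc_iff.1 h)]

theorem P_δ_eq_eqToHom_or_eq_comp_δ {m : ℕ} {x : SimplexCategoryGenRel} {f : x ⟶ mk (m + 1)}
    (hf : P_δ f) :
    (∃ h : x = mk (m + 1), f = eqToHom h) ∨ ∃ f₀ : x ⟶ mk m, P_δ f₀ ∧ ∃ k, f = f₀ ≫ δ k := by
  cases hf with
  | of _ h => cases h with | δ k => exact .inr ⟨𝟙 _, P_δ.id_mem _, k, (Category.id_comp _).symm⟩
  | id => exact .inl ⟨rfl, rfl⟩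
  | comp_of f₀ _ hf₀ h => cases h with | δ k => exact .inr ⟨f₀, hf₀, k, rfl⟩

theorem exists_eq_comp_δ_of_P_δ {m : ℕ} {x : SimplexCategoryGenRel} {f : x ⟶ mk (m + 1)}
    (hf : P_δ f) {i : Fin (m + 2)} (hi : ∀ a, toSimplexCategory.map f a ≠ i) :
    ∃ f' : x ⟶ mk m, f = f' ≫ δ i := by
  induction m generalizing x with
  | zero =>
    obtain ⟨rfl, rfl⟩ | ⟨f₀, -, k, rfl⟩ := P_δ_eq_eqToHom_or_eq_comp_δ hf
    · exact absurd rfl (hi i)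
    · obtain rfl | hk := eq_or_ne i k
      · exact ⟨f₀, rfl⟩
      · obtain ⟨i, rfl⟩ := Fin.exists_succAbove_eq hk
        refine absurd ?_ (hi 0)
        rw [Functor.map_comp]
        exact congrArg k.succAbove (Subsingleton.elim (α := Fin 1) _ _)
  | succ m ih =>
    obtain ⟨rfl, rfl⟩ | ⟨f₀, hf₀, k, rfl⟩ := P_δ_eq_eqToHom_or_eq_comp_δ hf
    · exact absurd rfl (hi i)
    · obtain rfl | hk := eq_or_ne i k
      · exact ⟨f₀, rfl⟩
      · obtain ⟨i, rfl⟩ := Fin.exists_succAbove_eq hk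
        obtain ⟨f', rfl⟩ := ih hf₀ fun a ha => hi a <| by
          rw [Functor.map_comp]
          exact congrArg k.succAbove ha
        exact ⟨f' ≫ δ (i.predAbove k), by
          rw [Category.assoc, Category.assoc, δ_comp_δ_swap]⟩

theorem toSimplexCategory_map_surjective_of_P_σ {x y : SimplexCategoryGenRel} {f : x ⟶ y}
    (hf : P_σ f) : Function.Surjective (toSimplexCategory.map f) := by
  have := isSplitEpi_toSimplexCategory_map_of_P_σ hf
  exact SimplexCategory.epi_iff_surjective.1 inferInstance

theorem exists_eq_comp_δ {m : ℕ} {x : SimplexCategoryGenRel} (f : x ⟶ mk (m + 1))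
    {i : Fin (m + 2)} (hi : ∀ a, toSimplexCategory.map f a ≠ i) :
    ∃ f' : x ⟶ mk m, f = f' ≫ δ i := by
  obtain ⟨z, e, d, he, hd, rfl⟩ := exists_P_σ_P_δ_factorization f
  obtain ⟨d, rfl⟩ := exists_eq_comp_δ_of_P_δ hd fun b hb => by
    obtain ⟨a, rfl⟩ := toSimplexCategory_map_surjective_of_P_σ he b
    refine hi a ?_
    rw [Functor.map_comp]
    exact hb
  exact ⟨e ≫ d, (Category.assoc _ _ _).symm⟩

theorem P_σ_of_surjective {x y : SimplexCategoryGenRel} {f : x ⟶ y}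
    (hf : Function.Surjective (toSimplexCategory.map f)) : P_σ f := by
  obtain ⟨z, e, d, he, hd, rfl⟩ := exists_P_σ_P_δ_factorization f
  obtain ⟨rfl, rfl⟩ | h := eq_or_len_le_of_P_δ hd
  · rwa [eqToHom_refl, Category.comp_id]
  · rw [Functor.map_comp] at hf
    have : Epi (toSimplexCategory.map d) := SimplexCategory.epi_iff_surjective.2
      (Function.Surjective.of_comp (g := toSimplexCategory.map e) hf)
    exact absurd (SimplexCategory.len_le_of_epi (toSimplexCategory.map d)) (not_le.2 h)

theorem toSimplexCategory_map_injective {x : SimplexCategoryGenRel} {m : ℕ} {f g : x ⟶ mk m}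
    (h : toSimplexCategory.map f = toSimplexCategory.map g) : f = g := by
  by_cases hf : Function.Surjective (toSimplexCategory.map f)
  · exact P_σ_eq_of_map_eq (P_σ_of_surjective hf) (P_σ_of_surjective (h ▸ hf)) h
  · obtain ⟨i, hi⟩ : ∃ i : Fin (m + 1), ¬∃ a, toSimplexCategory.map f a = i := not_forall.1 hf
    replace hi := not_exists.1 hi
    cases m with
    | zero => exact absurd (Subsingleton.elim (α := Fin 1) _ _) (hi 0)
    | succ m =>
      obtain ⟨f, rfl⟩ := exists_eq_comp_δ f hi
      obtain ⟨g, rfl⟩ := exists_eq_comp_δ g (h ▸ hi)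
      rw [Functor.map_comp, Functor.map_comp] at h
      have : Mono (SimplexCategory.δ (n := m) i) := inferInstance
      exact congrArg (· ≫ δ i) (toSimplexCategory_map_injective (this.right_cancellation _ _ h))
termination_by m

instance : toSimplexCategory.Faithful where
  map_injective {_ _ _ _} h := toSimplexCategory_map_injective h

instance : toSimplexCategory.Full where
  map_surjective {x y} φ := by
    let W : MorphismProperty SimplexCategory :=
      fun n m φ => ∃ f : mk n.len ⟶ mk m.len, toSimplexCategory.map f = φ
    have : W.IsMultiplicative :=
      { id_mem := fun _ => ⟨𝟙 _, toSimplexCategory.map_id _⟩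
        comp_mem := by
          rintro _ _ _ _ _ ⟨f, rfl⟩ ⟨g, rfl⟩
          exact ⟨f ≫ g, toSimplexCategory.map_comp f g⟩ }
    have hW : W = ⊤ :=
      SimplexCategory.morphismProperty_eq_top W (fun i => ⟨δ i, rfl⟩) fun i => ⟨σ i, rfl⟩
    have : W φ := hW ▸ MorphismProperty.top_apply φ
    exact this

instance : toSimplexCategory.EssSurj where
  mem_essImage n := ⟨mk n.len, ⟨Iso.refl _⟩⟩

instance : toSimplexCategory.IsEquivalence where

end SimplexPresentation

/-! ### Coaugmented cosimplicial objects with an extra codegeneracy -/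

/-- A coaugmented cosimplicial object of `D` with an extra codegeneracy in terms of generators and
relations. The degrees are shifted by one, so that `obj 0` is the coaugmentation, `obj (k + 1)` is
the term of cosimplicial degree `k`, and `codegen k 0` is the extra codegeneracy; the relations then
become uniform in all degrees. -/
structure SplitCosimplicialData (D : Type u) [Category.{v} D] where
  obj : ℕ → D
  coface (n : ℕ) (i : Fin (n + 1)) : obj n ⟶ obj (n + 1)
  codegen (n : ℕ) (j : Fin (n + 1)) : obj (n + 1) ⟶ obj n
  coface_comp_coface {n : ℕ} {i j : Fin (n + 1)} (h : i ≤ j) :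
    coface n i ≫ coface (n + 1) j.succ = coface n j ≫ coface (n + 1) i.castSucc
  codegen_comp_codegen {n : ℕ} {i j : Fin (n + 1)} (h : i ≤ j) :
    codegen (n + 1) i.castSucc ≫ codegen n j = codegen (n + 1) j.succ ≫ codegen n i
  coface_comp_codegen_self {n : ℕ} (i : Fin (n + 1)) : coface n i ≫ codegen n i = 𝟙 _
  coface_comp_codegen_succ {n : ℕ} (i : Fin (n + 1)) :
    coface (n + 1) i.castSucc ≫ codegen (n + 1) i.succ = 𝟙 _
  coface_succ_comp_codegen {n : ℕ} {i j : Fin (n + 1)} (h : j ≤ i) :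
    coface (n + 1) i.succ ≫ codegen (n + 1) j.castSucc = codegen n j ≫ coface n i
  coface_castSucc_comp_codegen {n : ℕ} {i j : Fin (n + 1)} (h : i < j) :
    coface (n + 1) i.castSucc ≫ codegen (n + 1) j.succ = codegen n j ≫ coface n i

namespace SplitCosimplicialData

variable {D : Type u} [Category.{v} D] (S : SplitCosimplicialData D)

/-- The cofaces and codegeneracies of the cosimplicial part on the generators of the simplex
category. -/
def prefunctor : FreeSimplexQuiver ⥤q D where
  obj n := S.obj (n.len + 1)
  map
    | .δ (n := n) i => S.coface (n + 1) i
    | .σ (n := n) j => S.codegen (n + 1) j.succ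

theorem lift_prefunctor_map_comp {a b c : FreeSimplexQuiver} (f : a ⟶ b) (g : b ⟶ c) :
    (Paths.lift S.prefunctor).map
      ((Paths.of FreeSimplexQuiver).map f ≫ (Paths.of FreeSimplexQuiver).map g) =
      S.prefunctor.map f ≫ S.prefunctor.map g :=
  congrArg (· ≫ S.prefunctor.map g) (Category.id_comp (S.prefunctor.map f))

/-- The cosimplicial part as a functor on the simplex category presented by generators and
relations. -/
def genRelFunctor : SimplexCategoryGenRel ⥤ D :=
  CategoryTheory.Quotient.lift _ (Paths.lift S.prefunctor) <| by
    rintro _ _ _ _ (H | H | _ | _ | H | H) <;> simp only [lift_prefunctor_map_comp]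
    · exact S.coface_comp_coface H
    · exact S.coface_castSucc_comp_codegen (Fin.le_castSucc_iff.1 H)
    · exact S.coface_comp_codegen_succ _
    · exact S.coface_comp_codegen_self _
    · exact S.coface_succ_comp_codegen (Fin.castSucc_lt_iff_succ_le.1 H)
    · exact S.codegen_comp_codegen (Fin.succ_le_succ_iff.2 H)

theorem genRelFunctor_map_δ {n : ℕ} (i : Fin (n + 2)) :
    S.genRelFunctor.map (SimplexCategoryGenRel.δ i) = S.coface (n + 1) i :=
  Category.id_comp _

theorem genRelFunctor_map_σ {n : ℕ} (j : Fin (n + 1)) :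
    S.genRelFunctor.map (SimplexCategoryGenRel.σ j) = S.codegen (n + 1) j.succ :=
  Category.id_comp _

/-- The cosimplicial part. -/
def cosimplicial : SimplexCategory ⥤ D :=
  SimplexCategoryGenRel.toSimplexCategory.inv ⋙ S.genRelFunctor

/-- The terms of the cosimplicial part. -/
def objIso (n : ℕ) : S.cosimplicial.obj (.mk n) ≅ S.obj (n + 1) :=
  S.genRelFunctor.mapIso (SimplexCategoryGenRel.toSimplexCategory.asEquivalence.unitIso.symm.app
    (SimplexCategoryGenRel.mk n))

theorem cosimplicial_map_comp_objIso_hom {n m : ℕ}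
    (f : SimplexCategoryGenRel.mk n ⟶ SimplexCategoryGenRel.mk m) :
    S.cosimplicial.map (SimplexCategoryGenRel.toSimplexCategory.map f) ≫ (S.objIso m).hom =
      (S.objIso n).hom ≫ S.genRelFunctor.map f := by
  have h := SimplexCategoryGenRel.toSimplexCategory.asEquivalence.unitIso.inv.naturality f
  exact (S.genRelFunctor.map_comp _ _).symm.trans
    ((congrArg S.genRelFunctor.map h).trans (S.genRelFunctor.map_comp _ _))

theorem cosimplicial_map_δ {n : ℕ} (i : Fin (n + 2)) :
    S.cosimplicial.map (SimplexCategory.δ i) =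
      (S.objIso n).hom ≫ S.coface (n + 1) i ≫ (S.objIso (n + 1)).inv := by
  rw [← Category.assoc, Iso.eq_comp_inv, ← genRelFunctor_map_δ]
  exact S.cosimplicial_map_comp_objIso_hom (SimplexCategoryGenRel.δ i)

theorem cosimplicial_map_σ {n : ℕ} (j : Fin (n + 1)) :
    S.cosimplicial.map (SimplexCategory.σ j) =
      (S.objIso (n + 1)).hom ≫ S.codegen (n + 1) j.succ ≫ (S.objIso n).inv := by
  rw [← Category.assoc, Iso.eq_comp_inv, ← genRelFunctor_map_σ]
  exact S.cosimplicial_map_comp_objIso_hom (SimplexCategoryGenRel.σ j)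

/-- The coaugmentation. -/
def coaug : S.obj 0 ⟶ S.cosimplicial.obj (.mk 0) :=
  S.coface 0 0 ≫ (S.objIso 0).inv

theorem coaug_comp_map_δ :
    S.coaug ≫ S.cosimplicial.map (SimplexCategory.δ 0) =
      S.coaug ≫ S.cosimplicial.map (SimplexCategory.δ 1) := by
  have h : S.coface 0 0 ≫ S.coface 1 1 = S.coface 0 0 ≫ S.coface 1 0 :=
    S.coface_comp_coface (n := 0) (i := 0) (j := 0) le_rfl
  simp only [coaug, cosimplicial_map_δ, Category.assoc, Iso.inv_hom_id_assoc]
  rw [reassoc_of% h]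

theorem coaug_comp_map {n : SimplexCategory} (g₁ g₂ : SimplexCategory.mk 0 ⟶ n) :
    S.coaug ≫ S.cosimplicial.map g₁ = S.coaug ≫ S.cosimplicial.map g₂ := by
  wlog h : g₁ 0 ≤ g₂ 0 generalizing g₁ g₂
  · exact (this g₂ g₁ (le_of_not_ge h)).symm
  obtain ⟨k, rfl, rfl⟩ : ∃ k : SimplexCategory.mk 1 ⟶ n,
      g₁ = SimplexCategory.δ 1 ≫ k ∧ g₂ = SimplexCategory.δ 0 ≫ k := by
    refine ⟨SimplexCategory.mkOfLe (g₁ 0) (g₂ 0) h, ?_, ?_⟩ <;>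
    · ext x
      obtain rfl : x = 0 := Subsingleton.elim (α := Fin 1) _ _
      rfl
  rw [Functor.map_comp, Functor.map_comp, ← Category.assoc, ← Category.assoc]
  exact congrArg (· ≫ S.cosimplicial.map k) S.coaug_comp_map_δ.symm

/-- The coaugmented cosimplicial object. -/
def augmented : CosimplicialObject.Augmented D :=
  CosimplicialObject.augment S.cosimplicial (S.obj 0) S.coaug fun _ => S.coaug_comp_map

theorem augmented_hom_app_zero : S.augmented.hom.app (.mk 0) = S.coaug :=
  CosimplicialObject.augment_hom_zero _ _ _ _

/-- The extra codegeneracy in cosimplicial degree `0`. -/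
def extraZero : S.cosimplicial.obj (.mk 0) ⟶ S.obj 0 :=
  (S.objIso 0).hom ≫ S.codegen 0 0

/-- The extra codegeneracy in positive cosimplicial degrees. -/
def extra (n : ℕ) : S.cosimplicial.obj (.mk (n + 1)) ⟶ S.cosimplicial.obj (.mk n) :=
  (S.objIso (n + 1)).hom ≫ S.codegen (n + 1) 0 ≫ (S.objIso n).inv

theorem coaug_comp_extraZero : S.coaug ≫ S.extraZero = 𝟙 _ := by
  simp only [coaug, extraZero, Category.assoc, Iso.inv_hom_id_assoc]
  exact S.coface_comp_codegen_self 0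

theorem map_δ_one_comp_extra :
    S.cosimplicial.map (SimplexCategory.δ 1) ≫ S.extra 0 = S.extraZero ≫ S.coaug := by
  have h : S.coface 1 1 ≫ S.codegen 1 0 = S.codegen 0 0 ≫ S.coface 0 0 :=
    S.coface_succ_comp_codegen (n := 0) (i := 0) (j := 0) le_rfl
  simp only [cosimplicial_map_δ, extra, extraZero, coaug, Category.assoc, Iso.inv_hom_id_assoc]
  rw [reassoc_of% h]

theorem map_δ_zero_comp_extra (n : ℕ) :
    S.cosimplicial.map (SimplexCategory.δ 0) ≫ S.extra n = 𝟙 _ := by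
  have h := S.coface_comp_codegen_self (n := n + 1) 0
  simp only [cosimplicial_map_δ, extra, Category.assoc, Iso.inv_hom_id_assoc, reassoc_of% h,
    Iso.hom_inv_id]

theorem map_δ_succ_comp_extra (n : ℕ) (i : Fin (n + 2)) :
    S.cosimplicial.map (SimplexCategory.δ i.succ) ≫ S.extra (n + 1) =
      S.extra n ≫ S.cosimplicial.map (SimplexCategory.δ i) := by
  have h := S.coface_succ_comp_codegen (n := n + 1) (i := i) (j := 0) (Fin.zero_le _)
  rw [Fin.castSucc_zero] at h
  simp only [cosimplicial_map_δ, extra, Category.assoc, Iso.inv_hom_id_assoc, reassoc_of% h]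

theorem map_σ_zero_comp_extraZero :
    S.cosimplicial.map (SimplexCategory.σ 0) ≫ S.extraZero = S.extra 0 ≫ S.extraZero := by
  have h : S.codegen 1 0 ≫ S.codegen 0 0 = S.codegen 1 1 ≫ S.codegen 0 0 :=
    S.codegen_comp_codegen (n := 0) (i := 0) (j := 0) le_rfl
  simp only [cosimplicial_map_σ, extra, extraZero, Category.assoc, Iso.inv_hom_id_assoc]
  rw [h]
  rfl

theorem map_σ_zero_comp_extra (n : ℕ) :
    S.cosimplicial.map (SimplexCategory.σ 0) ≫ S.extra n = S.extra (n + 1) ≫ S.extra n := by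
  have h := S.codegen_comp_codegen (n := n + 1) (i := 0) (j := 0) le_rfl
  rw [Fin.castSucc_zero] at h
  simp only [cosimplicial_map_σ, extra, Category.assoc, Iso.inv_hom_id_assoc, reassoc_of% h]

theorem map_σ_succ_comp_extra (n : ℕ) (i : Fin (n + 1)) :
    S.cosimplicial.map (SimplexCategory.σ i.succ) ≫ S.extra n =
      S.extra (n + 1) ≫ S.cosimplicial.map (SimplexCategory.σ i) := by
  have h := S.codegen_comp_codegen (n := n + 1) (i := 0) (j := i.succ) (Fin.zero_le _)
  rw [Fin.castSucc_zero] at h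
  simp only [cosimplicial_map_σ, extra, Category.assoc, Iso.inv_hom_id_assoc, reassoc_of% h]

/-- The extra codegeneracy of the coaugmented cosimplicial object. -/
def extraCodegeneracy : ExtraCodegeneracy S.augmented where
  s' := S.extraZero
  s := S.extra
  aug_s' := (congrArg (· ≫ S.extraZero) S.augmented_hom_app_zero).trans S.coaug_comp_extraZero
  δ_one_s := S.map_δ_one_comp_extra.trans
    (congrArg (S.extraZero ≫ ·) S.augmented_hom_app_zero.symm)
  δ_zero_s := S.map_δ_zero_comp_extra
  δ_succ_s := S.map_δ_succ_comp_extra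
  σ_zero_s' := S.map_σ_zero_comp_extraZero
  σ_zero_s := S.map_σ_zero_comp_extra
  σ_succ_s := S.map_σ_succ_comp_extra

theorem augmented_hom_app_comp_objIso_hom :
    S.augmented.hom.app (.mk 0) ≫ (S.objIso 0).hom = S.coface 0 0 := by
  have h : S.coaug ≫ (S.objIso 0).hom = S.coface 0 0 := by
    rw [coaug, Category.assoc, Iso.inv_hom_id, Category.comp_id]
  exact (congrArg (· ≫ (S.objIso 0).hom) S.augmented_hom_app_zero).trans h

theorem objIso_inv_comp_δ_comp_objIso_hom {n : ℕ} (i : Fin (n + 2)) :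
    (S.objIso n).inv ≫ S.augmented.right.δ i ≫ (S.objIso (n + 1)).hom = S.coface (n + 1) i := by
  refine (congrArg (fun d => (S.objIso n).inv ≫ d ≫ (S.objIso (n + 1)).hom)
    (S.cosimplicial_map_δ i)).trans ?_
  simp only [Category.assoc, Iso.inv_hom_id, Category.comp_id, Iso.inv_hom_id_assoc]

theorem objIso_inv_comp_σ_comp_objIso_hom {n : ℕ} (j : Fin (n + 1)) :
    (S.objIso (n + 1)).inv ≫ S.augmented.right.σ j ≫ (S.objIso n).hom =
      S.codegen (n + 1) j.succ := by
  refine (congrArg (fun s => (S.objIso (n + 1)).inv ≫ s ≫ (S.objIso n).hom)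
    (S.cosimplicial_map_σ j)).trans ?_
  simp only [Category.assoc, Iso.inv_hom_id, Category.comp_id, Iso.inv_hom_id_assoc]

theorem objIso_inv_comp_extraZero : (S.objIso 0).inv ≫ S.extraZero = S.codegen 0 0 :=
  (S.objIso 0).inv_hom_id_assoc _

theorem objIso_inv_comp_extra_comp_objIso_hom (n : ℕ) :
    (S.objIso (n + 1)).inv ≫ S.extra n ≫ (S.objIso n).hom = S.codegen (n + 1) 0 := by
  simp only [extra, Category.assoc, Iso.inv_hom_id, Category.comp_id, Iso.inv_hom_id_assoc]

end SplitCosimplicialData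

section

variable {C : Type u} [Category.{v} C] [MonoidalCategory C] [SymmetricCategory C]
  [HasLimitsOfSize.{0, 0} C] {O : Cooperad C} (M : LeftComodule O)

/-- The complex `M ⟶ O ∘̂ M ⇉ O ∘̂ O ∘̂ M ⋯`. -/
def LeftComodule.splitCosimplicialData : SplitCosimplicialData (SymSeq C) where
  obj := M.compProd
  coface := M.coface
  codegen := M.codegen
  coface_comp_coface := M.coface_comp_coface
  codegen_comp_codegen := M.codegen_comp_codegen
  coface_comp_codegen_self := M.coface_comp_codegen_self
  coface_comp_codegen_succ := M.coface_comp_codegen_succ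
  coface_succ_comp_codegen := M.coface_succ_comp_codegen
  coface_castSucc_comp_codegen := M.coface_castSucc_comp_codegen

end

end CooperadComplex

end

theorem theoremL {C : Type*} [Category C] [MonoidalCategory C] [SymmetricCategory C]
    [HasLimitsOfSize.{0, 0} C] (O : Cooperad C) (M : LeftComodule O) :
    (∀ (n : ℕ) (i : Fin (n + 1)), ∃! d, M.IsCoface n i d) ∧
    (∀ (n : ℕ) (j : Fin (n + 1)), ∃! s, M.IsCodegen n j s) ∧
    ∃ (X : CosimplicialObject.Augmented (SymSeq C)) (e₀ : X.left ≅ M.compProd 0)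
      (e : ∀ n : ℕ, X.right.obj (.mk n) ≅ M.compProd (n + 1)) (h : ExtraCodegeneracy X),
      M.IsCoface 0 0 (e₀.inv ≫ X.hom.app (.mk 0) ≫ (e 0).hom) ∧
      (∀ (n : ℕ) (i : Fin (n + 2)),
        M.IsCoface (n + 1) i ((e n).inv ≫ X.right.δ i ≫ (e (n + 1)).hom)) ∧
      (∀ (n : ℕ) (j : Fin (n + 1)),
        M.IsCodegen (n + 1) j.succ ((e (n + 1)).inv ≫ X.right.σ j ≫ (e n).hom)) ∧
      M.IsCodegen 0 0 ((e 0).inv ≫ h.s' ≫ e₀.hom) ∧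
      ∀ n : ℕ, M.IsCodegen (n + 1) 0 ((e (n + 1)).inv ≫ h.s n ≫ (e n).hom) := by
  let X := M.splitCosimplicialData
  refine ⟨M.existsUnique_isCoface, M.existsUnique_isCodegen, X.augmented, Iso.refl _, X.objIso,
    X.extraCodegeneracy, ?_, fun n i => ?_, fun n j => ?_, ?_, fun n => ?_⟩
  · exact ((Category.id_comp _).trans X.augmented_hom_app_comp_objIso_hom).symm ▸
      M.isCoface_coface 0 0
  · exact (X.objIso_inv_comp_δ_comp_objIso_hom i).symm ▸ M.isCoface_coface (n + 1) i
  · exact (X.objIso_inv_comp_σ_comp_objIso_hom j).symm ▸ M.isCodegen_codegen (n + 1) j.succ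
  · exact ((congrArg ((X.objIso 0).inv ≫ ·) (Category.comp_id X.extraZero)).trans
      X.objIso_inv_comp_extraZero).symm ▸ M.isCodegen_codegen 0 0
  · exact (X.objIso_inv_comp_extra_comp_objIso_hom n).symm ▸ M.isCodegen_codegen (n + 1) 0
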